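/- Let $\mathbb{F}_q$ be a finite field, let $m\ge 2$ and $0\le u\le t$ be integers, and let $1\le n_i\le m$ for $i=1,\dots,u$. Assume $m\mid t-u$. Let $$V=\mathbb{F}_q^{n_1\times m}\times\cdots\times\mathbb{F}_q^{n_u\times m}\times\mathbb{F}_q^{t-u},$$ with the sum-rank distance $\mathrm{d}(X,Y)=\sum_{i=1}^u\mathrm{rk}(X_i-Y_i)+|\{j: X_j\ne Y_j,\ u<j\le t\}|$ and the bilinear form $\langle X,Y\rangle=\sum_{i=1}^u\mathrm{Tr}(X_iY_i^{\mathsf t})+\sum_{j=u+1}^tX_jY_j$. A code is a linear subspace $\mathcal C\le V$, and $\mathcal C^\perp=\{y\in V:\langle x,y\rangle=0\text{ for all }x\in\mathcal C\}$. Codes $\mathcal C,\mathcal C'$ are isometric if $\phi(\mathcal C)=\mathcal C'$ for a linear map $\phi:V\to V$ with $\mathrm d(\phi(x),\phi(y))=\mathrm d(x,y)$ for all $x,y\in V$. An optimal anticode is a code $\mathcal A\le V$ with $\dim\mathcal A=\max\{\sum_{i=1}^u m\,\mathrm{rk}(X_i)+|\{j>u:X_j\ne0\}| : X\in\mathcal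 A\}$. A standard optimal anticode (SOA) is an optimal anticode isometric to a code generated by standard basis vectors (all entries $0$ except for one equal to $1$), and an $m$-SOA is an SOA whose dimension is divisible by $m$. Let $T$ be the family of $m$-SOAs in $V$. For $\ell\ge1$ dividing $\dim V$, a nonempty family of codes is a test family with step $\ell$ if (1) all its members have dimension divisible by $\ell$; (2) it is closed under $\mathcal T\mapsto\mathcal T^\perp$; (3) every member of dimension $a\ell>0$ contains a member of dimension $(a-1)\ell$; (4) every member of dimension $a\ell<\dim V$ is contained in a member of dimension $(a+1)\ell$. It is metric if it is closed under isometry. For a code $\mathcal C$ and $1\le r\le\dim\mathcal C$, the $r$-th $T$-weight is $\tau_r(\mathcal C)=\min\{\dim\mathcal T:\mathcal T\in T,\ \dim(\mathcal T\cap\mathcal C)\ge r\}$, and $\tau^h(\mathcal C)=(\tau_r(\mathcal C): 1\le r\le\dim\mathcal C,\ r\equiv h \bmod m)$. **Theorem.** (a) $\nu:=\dim V=m(n_1+\cdots+n_u)+t-u$, and the family $T$ of $m$-SOAs in $V$ is a metric test family with step $m$. (b) Let $\mathcal C\le V$ be a code of dimension $k$. For every $0\le h\le m-1$, $$\{\tau_s(\mathcal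 C^\perp):1\le s\le \nu-k,\ s\equiv h \bmod m\}=\{i : 1\le i\le\nu,\ m\mid i\}\setminus\{\nu+m-\tau_r(\mathcal C):1\le r\le k,\ r\equiv k+h \bmod m\}.$$ (c) For every $0\le h\le m-1$, the sequences $\tau^h(\mathcal C^\perp)$ and $\tau^{h+k}(\mathcal C)$ determine each other: for any codes $\mathcal C,\mathcal D\le V$ of the same dimension $k$, $\tau^h(\mathcal C^\perp)=\tau^h(\mathcal D^\perp)$ if and only if $\tau^{h+k}(\mathcal C)=\tau^{h+k}(\mathcal D)$. (d) If $u=t$ (no Hamming part), then $\tau_r(\mathcal C)=m\,d_r(\mathcal C)$ for every code $\mathcal C\le V$ and $1\le r\le\dim\mathcal C$, where $d_r(\mathcal C)=\min\{\sum_{i=1}^t\dim(\mathcal A_i)/m : \mathcal A_1\times\cdots\times\mathcal A_t\text{ an SOA in }V,\ \dim(\mathcal C\cap(\mathcal A_1\times\cdots\times\mathcal A_t))\ge r\}$ is the $r$-th generalized sum-rank weight. Thus (b) extends the known duality of generalized sum-rank weights. -/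

import Mathlib

noncomputable section

namespace TestFamily

/-! ### Families of codes in an arbitrary vector space -/

section General

variable {F V : Type*} [Field F] [AddCommGroup V] [Module F V]

/-- The dual code `C^⊥ = {y | ⟨x, y⟩ = 0 for all x ∈ C}` with respect to a bilinear form. -/
def dualCode (B : LinearMap.BilinForm F V) (C : Submodule F V) : Submodule F V :=
  B.orthogonal C

/-- `T` is a test family with step `ℓ` in `V`, the duals being taken with respect to `B`. -/
structure IsTestFamily (B : LinearMap.BilinForm F V) (ℓ : ℕ) (T : Set (Submodule F V)) :
    Prop where
  one_le_step : 1 ≤ ℓ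
  step_dvd_dim : ℓ ∣ Module.finrank F V
  nonempty : T.Nonempty
  step_dvd : ∀ A ∈ T, ℓ ∣ Module.finrank F A
  dual_mem : ∀ A ∈ T, dualCode B A ∈ T
  exists_le : ∀ A ∈ T, ∀ a : ℕ, Module.finrank F A = a * ℓ → 0 < a * ℓ →
    ∃ A' ∈ T, A' ≤ A ∧ Module.finrank F A' = (a - 1) * ℓ
  exists_ge : ∀ A ∈ T, ∀ a : ℕ, Module.finrank F A = a * ℓ → a * ℓ < Module.finrank F V →
    ∃ A' ∈ T, A ≤ A' ∧ Module.finrank F A' = (a + 1) * ℓ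

/-- Codes `C` and `C'` are isometric for the distance `d` if some distance-preserving linear map
of the ambient space sends `C` onto `C'`. -/
def Isometric (d : V → V → ℕ) (C C' : Submodule F V) : Prop :=
  ∃ φ : V →ₗ[F] V, C.map φ = C' ∧ ∀ x y, d x y = d (φ x) (φ y)

/-- A family of codes is metric if it is closed under isometry. -/
def IsMetricFamily (d : V → V → ℕ) (T : Set (Submodule F V)) : Prop :=
  ∀ A ∈ T, ∀ A' : Submodule F V, Isometric d A A' → A' ∈ T

/-- The `r`-th generalized `T`-weight
`τ_r(C) = min {dim A | A ∈ T, dim (A ∩ C) ≥ r}` (used for `1 ≤ r ≤ dim C`). -/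
def weight (T : Set (Submodule F V)) (C : Submodule F V) (r : ℕ) : ℕ :=
  sInf {w | ∃ A ∈ T, r ≤ Module.finrank F ↥(A ⊓ C) ∧ w = Module.finrank F A}

/-- The subsequence `τ^h(C) = (τ_r(C) | 1 ≤ r ≤ dim C, r ≡ h mod ℓ)` of the weight hierarchy. -/
def weightSeq (T : Set (Submodule F V)) (ℓ h : ℕ) (C : Submodule F V) : List ℕ :=
  ((List.range' 1 (Module.finrank F C)).filter fun r => r % ℓ = h % ℓ).map (weight T C)

end General

/-! ### The sum-rank metric space with matrix blocks of `m` columns and a Hamming part -/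

section SumRank

/-- `V = F^{n_1 × m} × ⋯ × F^{n_u × m} × F^a`. -/
abbrev Space (F : Type*) (m : ℕ) {u : ℕ} (n : Fin u → ℕ) (a : ℕ) : Type _ :=
  (∀ i : Fin u, Matrix (Fin (n i)) (Fin m) F) × (Fin a → F)

variable {F : Type*} [Field F] {m u a : ℕ} {n : Fin u → ℕ}

/-- The bilinear form `⟨X, Y⟩ = ∑ i, Tr (X_i Y_iᵀ) + ∑ j, x_j y_j`. -/
def sumTraceForm (F : Type*) [Field F] (m : ℕ) {u : ℕ} (n : Fin u → ℕ) (a : ℕ) :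
    LinearMap.BilinForm F (Space F m n a) :=
  LinearMap.mk₂ F
    (fun X Y => ∑ i, Matrix.trace (X.1 i * (Y.1 i).transpose) + ∑ j, X.2 j * Y.2 j)
    (fun X X' Y => by
      simp only [Prod.fst_add, Prod.snd_add, Pi.add_apply, Matrix.add_mul, Matrix.trace_add,
        add_mul, Finset.sum_add_distrib]
      ring)
    (fun c X Y => by
      simp only [Prod.smul_fst, Prod.smul_snd, Pi.smul_apply, Matrix.smul_mul, Matrix.trace_smul,
        smul_eq_mul, mul_assoc, mul_add, Finset.mul_sum])
    (fun X Y Y' => by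
      simp only [Prod.fst_add, Prod.snd_add, Pi.add_apply, Matrix.transpose_add, Matrix.mul_add,
        Matrix.trace_add, mul_add, Finset.sum_add_distrib]
      ring)
    (fun c X Y => by
      simp only [Prod.smul_fst, Prod.smul_snd, Pi.smul_apply, Matrix.transpose_smul,
        Matrix.mul_smul, Matrix.trace_smul, smul_eq_mul, mul_add, Finset.mul_sum,
        mul_left_comm])

open Classical in
/-- The sum-rank distance: the sum of the rank distances of the matrix blocks plus the Hamming
distance of the last components. -/
def srkDist (X Y : Space F m n a) : ℕ :=
  ∑ i, (X.1 i - Y.1 i).rank + hammingDist X.2 Y.2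

open Classical in
/-- The quantity `∑ i, m_i rk (X_i)` of the anticode bound: matrix blocks have `m_i = m`, and each
coordinate of the Hamming part is a `1 × 1` block. -/
def anticodeWeight (X : Space F m n a) : ℕ :=
  ∑ i, m * (X.1 i).rank + hammingNorm X.2

/-- Optimal anticodes attain the bound `dim A ≤ max {∑ i, m_i rk (X_i) | X ∈ A}`. -/
def IsOptimalAnticode (A : Submodule F (Space F m n a)) : Prop :=
  IsGreatest {w | ∃ X ∈ A, w = anticodeWeight X} (Module.finrank F A)

/-- The standard basis vectors of `V`: one component is `1` and all the others are `0`. -/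
def standardBasis (F : Type*) [Field F] (m : ℕ) {u : ℕ} (n : Fin u → ℕ) (a : ℕ) :
    Set (Space F m n a) :=
  {X | (∃ (i : Fin u) (r : Fin (n i)) (c : Fin m), X = (Pi.single i (Matrix.single r c 1), 0)) ∨
    ∃ j : Fin a, X = (0, Pi.single j 1)}

/-- A standard optimal anticode is an optimal anticode which is isometric to a code generated by
standard basis vectors. -/
def IsSOA (A : Submodule F (Space F m n a)) : Prop :=
  IsOptimalAnticode A ∧
    ∃ S ⊆ standardBasis F m n a, Isometric srkDist A (Submodule.span F S)

/-- The family of `m`-standard optimal anticodes: those whose dimension is divisible by `m`. -/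
def mSOA (F : Type*) [Field F] (m : ℕ) {u : ℕ} (n : Fin u → ℕ) (a : ℕ) :
    Set (Submodule F (Space F m n a)) :=
  {A | IsSOA A ∧ m ∣ Module.finrank F A}

/-- The code `A_1 × ⋯ × A_u × B_1 × ⋯ × B_a`. -/
def productCode (A : ∀ i : Fin u, Submodule F (Matrix (Fin (n i)) (Fin m) F))
    (B : Fin a → Submodule F F) : Submodule F (Space F m n a) :=
  (Submodule.pi Set.univ A).prod (Submodule.pi Set.univ B)

/-- The `r`-th generalized sum-rank weight: the minimum of `∑ i, dim (A_i) / m_i` over all standard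
optimal anticodes `A_1 × ⋯ × A_t` that meet `C` in dimension at least `r`. -/
def gsrWeight (C : Submodule F (Space F m n a)) (r : ℕ) : ℝ :=
  sInf {w | ∃ (A : ∀ i : Fin u, Submodule F (Matrix (Fin (n i)) (Fin m) F))
      (B : Fin a → Submodule F F), IsSOA (productCode A B) ∧
      r ≤ Module.finrank F ↥(C ⊓ productCode A B) ∧
      w = ∑ i, (Module.finrank F (A i) : ℝ) / m + ∑ j, (Module.finrank F (B j) : ℝ)}

end SumRank

end TestFamily

end

/-! Write ℓ for the step, ν = Nℓ for the dimension of the ambient space and k = dim C. The duality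
depends only on the profile f_C(a) = max dim(A ∩ C), over members A of dimension aℓ (`meetDim`). The
chain axioms make it climb from 0 to k by increments between 0 and ℓ, and τ_r(C) = (a+1)ℓ exactly
when f_C(a) < r ≤ f_C(a+1). Since dim(A^⊥ ∩ C^⊥) = ν - dim A - k + dim(A ∩ C), closure under duals
gives f_{C^⊥}(a) + k = aℓ + f_C(N-a). Hence the interval crossed by the profile of C^⊥ between a and
a+1, translated by k - aℓ, is the complement of (f_C(N-1-a), f_C(N-a)] in a window of ℓ consecutive
integers. Each residue class mod ℓ meets the window once, so it meets exactly one of the two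
intervals: this is `weight_duality`.

For m-SOAs the axioms are read off from `isSOA_iff`: up to maps X_i ↦ P_i X_i Q_i, an SOA is a
coordinate code whose positions form, in each block, full rows or (square blocks only) full columns.
Optimality forces this shape because, by averaging over cyclic shifts, all graphs of injections
carry equally many positions (`lineClosed_of_isOptimalAnticode`).

Isometries need not be classified. A space of dimension at least 2 and weights at most 1 lies in one
matrix block, with a common row or column direction (`IsThin.exists_block`). As m ≥ 2, isometries
therefore respect the matrix and Hamming parts and preserve `anticodeWeight`, and SOAs are sums of
m-dimensional lines and Hamming lines. Bases adapted to these lines make an SOA a coordinate code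
(`IsLineGenerated.exists_blockMap`). On position sets, duality is complementation, and chains remove
or add m positions. Without Hamming part, an SOA is a product of blocks of dimension divisible by m,
whence (d). -/

noncomputable section

namespace TestFamily

/-! ### Wei duality for an arbitrary test family -/

section Duality

open Module

variable {F V : Type*} [Field F] [AddCommGroup V] [Module F V]

/-- The largest dimension of the intersection of `C` with a member of `T` of dimension `d`. -/
def meetDim (T : Set (Submodule F V)) (C : Submodule F V) (d : ℕ) : ℕ :=
  sSup {e | ∃ A ∈ T, finrank F A = d ∧ e = finrank F ↥(A ⊓ C)}

variable {B : LinearMap.BilinForm F V} {ℓ N : ℕ} {T : Set (Submodule F V)} {C : Submodule F V}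

lemma IsTestFamily.exists_finrank_eq_of_le (hT : IsTestFamily B ℓ T) {A : Submodule F V} (hA : A ∈ T) {a : ℕ}
    (ha : finrank F A = a * ℓ) {b : ℕ} (hb : b ≤ a) :
    ∃ A' ∈ T, finrank F A' = b * ℓ := by
  induction a generalizing A with
  | zero => exact ⟨A, hA, by rw [ha, Nat.le_zero.1 hb]⟩
  | succ a ih =>
    rcases Nat.lt_or_ge a b with h | h
    · exact ⟨A, hA, by rw [ha, show b = a + 1 by omega]⟩
    · obtain ⟨A', hA', -, h'⟩ := hT.exists_le A hA (a + 1) ha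
        (Nat.mul_pos a.succ_pos hT.one_le_step)
      exact ih hA' (by simpa using h') h

lemma mem_weightSeq {h w : ℕ} : w ∈ weightSeq T ℓ h C ↔
    ∃ r ∈ Set.Icc 1 (finrank F C), r ≡ h [MOD ℓ] ∧ w = weight T C r := by
  simp only [weightSeq, List.mem_map, List.mem_filter, List.mem_range'_1, decide_eq_true_eq,
    Set.mem_Icc, Nat.ModEq]
  constructor
  · rintro ⟨r, ⟨h1, h2⟩, rfl⟩
    exact ⟨r, ⟨h1.1, by omega⟩, h2, rfl⟩
  · rintro ⟨r, ⟨h1, h2⟩, h3, rfl⟩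
    exact ⟨r, ⟨⟨h1, by omega⟩, h3⟩, rfl⟩

variable [FiniteDimensional F V]

lemma meetDim_bddAbove (T : Set (Submodule F V)) (C : Submodule F V) (d : ℕ) :
    BddAbove {e | ∃ A ∈ T, finrank F A = d ∧ e = finrank F ↥(A ⊓ C)} := by
  refine ⟨finrank F C, ?_⟩
  rintro e ⟨A, -, -, rfl⟩
  exact Submodule.finrank_mono inf_le_right

lemma finrank_inf_le_meetDim {A : Submodule F V} (hA : A ∈ T) (C : Submodule F V) :
    finrank F ↥(A ⊓ C) ≤ meetDim T C (finrank F A) :=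
  le_csSup (meetDim_bddAbove T C _) ⟨A, hA, rfl, rfl⟩

lemma finrank_dualCode (hB : B.Nondegenerate) (C : Submodule F V) :
    finrank F (dualCode B C) = finrank F V - finrank F C :=
  LinearMap.BilinForm.finrank_orthogonal hB C

lemma finrank_inf_dualCode (hB : B.Nondegenerate) (A C : Submodule F V) :
    finrank F ↥(dualCode B A ⊓ dualCode B C) + finrank F A + finrank F C =
      finrank F V + finrank F ↥(A ⊓ C) := by
  have h1 : dualCode B A ⊓ dualCode B C = dualCode B (A ⊔ C) := by
    refine le_antisymm ?_ (le_inf (LinearMap.BilinForm.orthogonal_le le_sup_left)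
      (LinearMap.BilinForm.orthogonal_le le_sup_right))
    rintro y ⟨hyA, hyC⟩ x hx
    obtain ⟨p, hp, q, hq, rfl⟩ := Submodule.mem_sup.1 hx
    have e1 : B p y = 0 := hyA p hp
    have e2 : B q y = 0 := hyC q hq
    simp [e1, e2]
  rw [h1, finrank_dualCode hB]
  have h2 := Submodule.finrank_sup_add_finrank_inf_eq A C
  have h3 := Submodule.finrank_le (A ⊔ C)
  omega

namespace IsTestFamily

/-- The extension axiom climbs from any member and can only stop at the whole space. -/
lemma top_mem (hT : IsTestFamily B ℓ T) : (⊤ : Submodule F V) ∈ T := by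
  obtain ⟨N, hN⟩ := hT.step_dvd_dim
  have key : ∀ d : ℕ, ∀ A ∈ T, ∀ a, finrank F A = a * ℓ → N ≤ a + d →
      (⊤ : Submodule F V) ∈ T := by
    intro d
    induction d with
    | zero =>
      intro A hA a ha hd
      have h1 : finrank F V ≤ finrank F A := by
        rw [hN, ha, mul_comm]; exact Nat.mul_le_mul_right _ hd
      rwa [← Submodule.eq_top_of_finrank_eq (le_antisymm (Submodule.finrank_le A) h1)]
    | succ d ih =>
      intro A hA a ha hd
      by_cases h : a * ℓ < finrank F V
      · obtain ⟨A', hA', -, h'⟩ := hT.exists_ge A hA a ha h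
        exact ih A' hA' (a + 1) h' (by omega)
      · rwa [← Submodule.eq_top_of_finrank_eq (le_antisymm (Submodule.finrank_le A) (by omega))]
  obtain ⟨A, hA⟩ := hT.nonempty
  obtain ⟨a, ha⟩ := hT.step_dvd A hA
  exact key N A hA a (by rw [ha, mul_comm]) (by omega)

lemma exists_finrank_eq (hT : IsTestFamily B ℓ T) (hN : finrank F V = N * ℓ) {a : ℕ}
    (ha : a ≤ N) : ∃ A ∈ T, finrank F A = a * ℓ :=
  hT.exists_finrank_eq_of_le hT.top_mem (by rw [finrank_top, hN]) ha

lemma exists_meetDim_eq (hT : IsTestFamily B ℓ T) (hN : finrank F V = N * ℓ)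
    (C : Submodule F V) {a : ℕ} (ha : a ≤ N) :
    ∃ A ∈ T, finrank F A = a * ℓ ∧ meetDim T C (a * ℓ) = finrank F ↥(A ⊓ C) := by
  obtain ⟨A, hA, h⟩ := hT.exists_finrank_eq hN ha
  have hne : {e | ∃ A ∈ T, finrank F A = a * ℓ ∧ e = finrank F ↥(A ⊓ C)}.Nonempty :=
    ⟨_, A, hA, h, rfl⟩
  exact Nat.sSup_mem hne (meetDim_bddAbove T C _)

lemma meetDim_zero (hT : IsTestFamily B ℓ T) (hN : finrank F V = N * ℓ) (C : Submodule F V) :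
    meetDim T C (0 * ℓ) = 0 := by
  obtain ⟨A, hA, h, h'⟩ := hT.exists_meetDim_eq hN C (Nat.zero_le N)
  have := Submodule.finrank_mono (R := F) (inf_le_left : A ⊓ C ≤ A)
  omega

lemma meetDim_top (hT : IsTestFamily B ℓ T) (hN : finrank F V = N * ℓ) (C : Submodule F V) :
    meetDim T C (N * ℓ) = finrank F C := by
  obtain ⟨A, hA, h, h'⟩ := hT.exists_meetDim_eq hN C le_rfl
  rw [h', Submodule.eq_top_of_finrank_eq (h.trans hN.symm), top_inf_eq]

lemma meetDim_le_succ (hT : IsTestFamily B ℓ T) (hN : finrank F V = N * ℓ) (C : Submodule F V)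
    {a : ℕ} (ha : a < N) : meetDim T C (a * ℓ) ≤ meetDim T C ((a + 1) * ℓ) := by
  obtain ⟨A, hA, h, h'⟩ := hT.exists_meetDim_eq hN C ha.le
  obtain ⟨A', hA', hle, hf⟩ := hT.exists_ge A hA a h
    (by rw [hN]; exact Nat.mul_lt_mul_of_pos_right ha hT.one_le_step)
  rw [h', ← hf]
  exact (Submodule.finrank_mono (inf_le_inf_right C hle)).trans (finrank_inf_le_meetDim hA' C)

/-- A maximizer contains a member of codimension ℓ, whose intersection with `C` loses at most ℓ
dimensions. -/
lemma meetDim_succ_le (hT : IsTestFamily B ℓ T) (hN : finrank F V = N * ℓ) (C : Submodule F V)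
    {a : ℕ} (ha : a < N) : meetDim T C ((a + 1) * ℓ) ≤ meetDim T C (a * ℓ) + ℓ := by
  obtain ⟨A, hA, h, h'⟩ := hT.exists_meetDim_eq hN C ha
  obtain ⟨A', hA', hle, hf⟩ := hT.exists_le A hA (a + 1) h
    (Nat.mul_pos a.succ_pos hT.one_le_step)
  have h1 := finrank_inf_le_meetDim hA' C
  rw [hf, Nat.add_sub_cancel] at h1
  have h2 := Submodule.finrank_sup_add_finrank_inf_eq A' (A ⊓ C)
  have h3 : A' ⊓ (A ⊓ C) = A' ⊓ C := by rw [← inf_assoc, inf_eq_left.2 hle]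
  have h4 := Submodule.finrank_mono (R := F) (sup_le hle (inf_le_left : A ⊓ C ≤ A))
  rw [h3] at h2
  rw [h] at h4
  rw [h']
  rw [Nat.succ_mul] at h4
  simp only [Nat.add_sub_cancel] at hf
  omega

lemma meetDim_mono (hT : IsTestFamily B ℓ T) (hN : finrank F V = N * ℓ) (C : Submodule F V)
    {a b : ℕ} (hab : a ≤ b) (hb : b ≤ N) : meetDim T C (a * ℓ) ≤ meetDim T C (b * ℓ) := by
  induction b, hab using Nat.le_induction with
  | base => exact le_rfl
  | succ b _ ih => exact (ih (by omega)).trans (hT.meetDim_le_succ hN C (by omega))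

/-- The dual of a maximizer for one side is a competitor for the other, and `finrank_inf_dualCode`
compares the two intersections. Each inequality dualizes one maximizer. -/
lemma meetDim_dualCode (hT : IsTestFamily B ℓ T) (hN : finrank F V = N * ℓ)
    (hB : B.Nondegenerate) (hR : B.IsRefl) (C : Submodule F V) {a : ℕ} (ha : a ≤ N) :
    meetDim T (dualCode B C) (a * ℓ) + finrank F C = a * ℓ + meetDim T C ((N - a) * ℓ) := by
  have hs : (N - a) * ℓ + a * ℓ = N * ℓ := by rw [← add_mul, Nat.sub_add_cancel ha]
  have hdual : ∀ A ∈ T, finrank F ↥(dualCode B A) = finrank F V - finrank F A := fun A _ =>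
    finrank_dualCode hB A
  apply le_antisymm
  · obtain ⟨A, hA, h, h'⟩ := hT.exists_meetDim_eq hN (dualCode B C) ha
    have h1 := finrank_inf_le_meetDim (hT.dual_mem A hA) C
    have h2 := finrank_inf_dualCode hB A (dualCode B C)
    have h4 : dualCode B (dualCode B C) = C :=
      LinearMap.BilinForm.orthogonal_orthogonal hB hR C
    rw [h4, finrank_dualCode hB] at h2
    rw [hdual A hA, show finrank F V - finrank F A = (N - a) * ℓ by omega] at h1
    have := Submodule.finrank_le C
    omega
  · obtain ⟨A, hA, h, h'⟩ := hT.exists_meetDim_eq hN C (Nat.sub_le N a)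
    have h1 := finrank_inf_le_meetDim (hT.dual_mem A hA) (dualCode B C)
    have h2 := finrank_inf_dualCode hB A C
    rw [hdual A hA, show finrank F V - finrank F A = a * ℓ by omega] at h1
    omega

lemma weight_eq (hT : IsTestFamily B ℓ T) (hN : finrank F V = N * ℓ) {a r : ℕ} (ha : a < N)
    (hr : meetDim T C (a * ℓ) < r) (hr' : r ≤ meetDim T C ((a + 1) * ℓ)) :
    weight T C r = (a + 1) * ℓ := by
  have : IsLeast {w | ∃ A ∈ T, r ≤ finrank F ↥(A ⊓ C) ∧ w = finrank F A} ((a + 1) * ℓ) := by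
    constructor
    · obtain ⟨A, hA, h, h'⟩ := hT.exists_meetDim_eq hN C (Nat.succ_le_of_lt ha)
      exact ⟨A, hA, by rwa [← h'], h.symm⟩
    · rintro w ⟨A, hA, h, rfl⟩
      obtain ⟨b, hb⟩ := hT.step_dvd A hA
      have h1 := finrank_inf_le_meetDim hA C
      rw [mul_comm] at hb
      rw [hb] at h1 ⊢
      apply Nat.mul_le_mul_right
      by_contra hlt
      have := hT.meetDim_mono hN C (show b ≤ a by omega) ha.le
      omega
  exact this.csInf_eq

lemma exists_weight_eq (hT : IsTestFamily B ℓ T) (hN : finrank F V = N * ℓ) {r : ℕ}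
    (hr : 1 ≤ r) (hr' : r ≤ finrank F C) :
    ∃ a < N, meetDim T C (a * ℓ) < r ∧ r ≤ meetDim T C ((a + 1) * ℓ) ∧
      weight T C r = (a + 1) * ℓ := by
  have hex : ∃ a, r ≤ meetDim T C (a * ℓ) := ⟨N, by rwa [hT.meetDim_top hN]⟩
  classical
  have h0 := hT.meetDim_zero hN C
  have h1 := Nat.find_spec hex
  obtain ⟨a, ha⟩ : ∃ a, Nat.find hex = a + 1 := by
    refine Nat.exists_eq_succ_of_ne_zero fun h => ?_
    rw [h] at h1
    omega
  have h2 : a < N := by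
    have := Nat.find_min' hex (show r ≤ meetDim T C (N * ℓ) by rwa [hT.meetDim_top hN])
    omega
  have h3 := Nat.find_min hex (show a < Nat.find hex by omega)
  rw [ha] at h1
  exact ⟨a, h2, by omega, h1, hT.weight_eq hN h2 (by omega) h1⟩

/-- One step of the profile crosses a half-open interval of length at most ℓ, too short for two
members of a residue class. -/
lemma weight_lt_weight (hT : IsTestFamily B ℓ T) {r s : ℕ} (hr : 1 ≤ r) (hs : s ≤ finrank F C)
    (hrs : r < s) (h : r ≡ s [MOD ℓ]) : weight T C r < weight T C s := by
  obtain ⟨N, hN⟩ := hT.step_dvd_dim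
  rw [mul_comm] at hN
  obtain ⟨a, ha, h1, h2, h3⟩ := hT.exists_weight_eq hN hr (hrs.le.trans hs)
  obtain ⟨b, hb, h4, h5, h6⟩ := hT.exists_weight_eq hN (hr.trans hrs.le) hs
  rw [h3, h6]
  refine Nat.mul_lt_mul_of_pos_right ?_ hT.one_le_step
  by_contra hle
  have h7 := hT.meetDim_succ_le hN C ha
  have h8 := hT.meetDim_mono hN C (show b + 1 ≤ a + 1 by omega) ha
  obtain ⟨c, hc⟩ := (Nat.modEq_iff_dvd' hrs.le).1 h
  have : ℓ ≤ s - r := Nat.le_of_dvd (by omega) ⟨c, hc⟩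
  omega

/-- The values of the weight hierarchy along a residue class are the dimensions at which the
profile `meetDim` jumps over a member of the class. -/
lemma exists_weight_iff (hT : IsTestFamily B ℓ T) (hN : finrank F V = N * ℓ) {h w : ℕ} :
    (∃ r ∈ Set.Icc 1 (finrank F C), r ≡ h [MOD ℓ] ∧ w = weight T C r) ↔
      ∃ a < N, w = (a + 1) * ℓ ∧ ∃ x : ℤ, (meetDim T C (a * ℓ) : ℤ) < x ∧
        x ≤ (meetDim T C ((a + 1) * ℓ) : ℤ) ∧ (ℓ : ℤ) ∣ x - h := by
  constructor
  · rintro ⟨r, ⟨hr, hr'⟩, hmod, rfl⟩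
    obtain ⟨a, ha, h1, h2, h3⟩ := hT.exists_weight_eq hN hr hr'
    exact ⟨a, ha, h3, r, by exact_mod_cast h1, by exact_mod_cast h2,
      (Nat.modEq_iff_dvd).1 hmod.symm⟩
  · rintro ⟨a, ha, rfl, x, h1, h2, h3⟩
    lift x to ℕ using by omega
    have h4 := hT.meetDim_mono hN C (show a + 1 ≤ N by omega) le_rfl
    rw [hT.meetDim_top hN] at h4
    refine ⟨x, ⟨by omega, by omega⟩, (Nat.modEq_iff_dvd.2 h3).symm, ?_⟩
    rw [hT.weight_eq hN ha (by omega) (by omega)]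

/-- Wei duality for the generalized weights of a test family. -/
theorem weight_duality (hT : IsTestFamily B ℓ T) (hB : B.Nondegenerate) (hR : B.IsRefl)
    (C : Submodule F V) (h : ℕ) :
    {w | ∃ s ∈ Set.Icc 1 (finrank F (dualCode B C)), s ≡ h [MOD ℓ] ∧
        w = weight T (dualCode B C) s} =
      {w | w ∈ Set.Icc 1 (finrank F V) ∧ ℓ ∣ w} \
        {w | ∃ r ∈ Set.Icc 1 (finrank F C), r ≡ finrank F C + h [MOD ℓ] ∧
          w = finrank F V + ℓ - weight T C r} := by
  obtain ⟨N, hN⟩ := hT.step_dvd_dim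
  rw [mul_comm] at hN
  have hℓ := hT.one_le_step
  -- The two intervals, one of them translated by k - aℓ, partition ℓ consecutive integers; the
  -- translation turns the class of h into that of k + h.
  have key : ∀ a < N, (∃ x : ℤ, (meetDim T (dualCode B C) (a * ℓ) : ℤ) < x ∧
        x ≤ (meetDim T (dualCode B C) ((a + 1) * ℓ) : ℤ) ∧ (ℓ : ℤ) ∣ x - h) ↔
      ¬ ∃ x : ℤ, (meetDim T C ((N - 1 - a) * ℓ) : ℤ) < x ∧
        x ≤ (meetDim T C ((N - 1 - a + 1) * ℓ) : ℤ) ∧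
          (ℓ : ℤ) ∣ x - (finrank F C + h : ℕ) := by
    intro a ha
    have e1 := hT.meetDim_dualCode hN hB hR C ha.le
    have e2 := hT.meetDim_dualCode hN hB hR C (show a + 1 ≤ N by omega)
    have e3 := hT.meetDim_succ_le hN C (show N - 1 - a < N by omega)
    have e4 := hT.meetDim_le_succ hN C (show N - 1 - a < N by omega)
    rw [show N - a = N - 1 - a + 1 by omega] at e1
    rw [show N - (a + 1) = N - 1 - a by omega, show (a + 1) * ℓ = a * ℓ + ℓ by ring] at e2
    rw [show (a + 1) * ℓ = a * ℓ + ℓ by ring]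
    generalize meetDim T C ((N - 1 - a + 1) * ℓ) = p at *
    generalize meetDim T C ((N - 1 - a) * ℓ) = q at *
    generalize meetDim T (dualCode B C) (a * ℓ + ℓ) = p' at *
    generalize meetDim T (dualCode B C) (a * ℓ) = q' at *
    generalize finrank F C = k at *
    constructor
    -- With members in both intervals, the multiple ℓ(d - c + a) = y - (x + k - aℓ) of ℓ would lie
    -- strictly between -ℓ and 0.
    · rintro ⟨x, hx1, hx2, c, hc⟩ ⟨y, hy1, hy2, d, hd⟩
      have h1 : y = x + k + ℓ * (d - c) := by push_cast at hd; linarith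
      have h2 : x + k = ℓ * c + h + k := by linarith
      zify at e1 e2 e3 e4
      have hu1 : (ℓ : ℤ) * (d - c + a) > - ℓ + 0 := by nlinarith
      have hu2 : (ℓ : ℤ) * (d - c + a) < 0 := by nlinarith
      have hl : (0 : ℤ) < ℓ := by exact_mod_cast hℓ
      have h3 : d - c + a < 0 := by
        by_contra hcon
        have := mul_nonneg hl.le (not_lt.1 hcon)
        linarith
      nlinarith
    · intro hno
      by_contra hno'
      have hl : (0 : ℤ) < ℓ := by exact_mod_cast hℓ
      -- `z` is the largest integer at most `p` in the class of k + h. Either it lies in (q, p], or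
      -- z + ℓ lies in (p, q + ℓ], which is the translated interval of the dual code.
      set z : ℤ := p - ((p : ℤ) - (k + h : ℕ)) % ℓ with hz
      have hz1 := Int.emod_nonneg ((p : ℤ) - (k + h : ℕ)) hl.ne'
      have hz2 := Int.emod_lt_of_pos ((p : ℤ) - (k + h : ℕ)) hl
      have hz3 : (ℓ : ℤ) ∣ z - (k + h : ℕ) := by
        have := Int.dvd_self_sub_emod (x := (p : ℤ) - (k + h : ℕ)) (m := ℓ)
        convert this using 1
        rw [hz]; ring
      by_cases hq : (q : ℤ) < z
      · exact hno ⟨z, hq, by omega, hz3⟩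
      · refine hno' ⟨z + (a * ℓ + ℓ) - k, ?_, ?_, ?_⟩
        · zify at e1; linarith
        · zify at e2; linarith
        · obtain ⟨c, hc⟩ := hz3
          exact ⟨c + a + 1, by push_cast at hc; linarith⟩
  ext w
  rw [Set.mem_ofPred_eq, hT.exists_weight_iff hN, Set.mem_sdiff]
  constructor
  · rintro ⟨a, ha, rfl, hx⟩
    refine ⟨⟨⟨Nat.mul_pos a.succ_pos hℓ, ?_⟩, Dvd.intro_left _ rfl⟩, ?_⟩
    · rw [hN]; exact Nat.mul_le_mul_right _ ha
    · rintro ⟨r, hr, hmod, hw⟩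
      refine (key a ha).1 hx ?_
      obtain ⟨b, hb, h1, h2⟩ := (hT.exists_weight_iff hN (C := C)).1 ⟨r, hr, hmod, rfl⟩
      have hb' : (b + 1) * ℓ ≤ N * ℓ := Nat.mul_le_mul_right _ hb
      have h3 : (a + 1 + (b + 1)) * ℓ = (N + 1) * ℓ := by
        rw [add_mul, hw, hN, h1, add_mul N]; omega
      have h4 := Nat.eq_of_mul_eq_mul_right hℓ h3
      rwa [show N - 1 - a = b by omega]
  · rintro ⟨⟨⟨hw1, hw2⟩, c, rfl⟩, hnot⟩
    obtain ⟨a, rfl⟩ : ∃ a, c = a + 1 :=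
      Nat.exists_eq_succ_of_ne_zero (by rintro rfl; simp at hw1)
    rw [mul_comm, hN] at hw2
    have ha : a < N := Nat.le_of_mul_le_mul_right hw2 hℓ
    refine ⟨a, ha, mul_comm _ _, (key a ha).2 fun hx => hnot ?_⟩
    obtain ⟨r, hr, hmod, hw⟩ := (hT.exists_weight_iff hN (C := C)).2
      ⟨N - 1 - a, by omega, rfl, hx⟩
    refine ⟨r, hr, hmod, ?_⟩
    have h3 : (a + 1 + (N - 1 - a + 1)) * ℓ = (N + 1) * ℓ := by congr 1; omega
    rw [← hw, hN, mul_comm]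
    rw [add_mul, add_mul N] at h3
    omega

lemma weightSeq_pairwise (hT : IsTestFamily B ℓ T) (C : Submodule F V) (h : ℕ) :
    (weightSeq T ℓ h C).Pairwise (· < ·) := by
  rw [weightSeq, List.pairwise_map]
  have h1 : ((List.range' 1 (finrank F C)).filter fun r => r % ℓ = h % ℓ).Pairwise (· < ·) :=
    List.Pairwise.filter _ List.pairwise_lt_range'
  refine h1.imp_of_mem fun {r s} hr hs hlt => ?_
  simp only [List.mem_filter, List.mem_range'_1, decide_eq_true_eq] at hr hs
  exact hT.weight_lt_weight hr.1.1 (by omega) hlt (hr.2.trans hs.2.symm)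

/-- The sequences are strictly increasing, so their sets of values determine them. -/
lemma weightSeq_eq_iff (hT : IsTestFamily B ℓ T) {C D : Submodule F V} {h h' : ℕ} :
    weightSeq T ℓ h C = weightSeq T ℓ h' D ↔
      {w | ∃ r ∈ Set.Icc 1 (finrank F C), r ≡ h [MOD ℓ] ∧ w = weight T C r} =
        {w | ∃ r ∈ Set.Icc 1 (finrank F D), r ≡ h' [MOD ℓ] ∧ w = weight T D r} := by
  simp only [← mem_weightSeq]
  refine ⟨fun h => by rw [h], fun hset => ?_⟩
  have hC := hT.weightSeq_pairwise C h
  have hD := hT.weightSeq_pairwise D h'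
  refine List.Perm.eq_of_pairwise (le := (· < ·)) (fun a b _ _ h1 h2 => absurd h1 h2.asymm) hC hD ?_
  exact (List.perm_ext_iff_of_nodup (hC.imp fun h => h.ne) (hD.imp fun h => h.ne)).2
    fun w => Set.ext_iff.1 hset w

theorem weightSeq_dualCode_eq_iff (hT : IsTestFamily B ℓ T) (hB : B.Nondegenerate)
    (hR : B.IsRefl) {C D : Submodule F V} (hCD : finrank F C = finrank F D) (h : ℕ) :
    weightSeq T ℓ h (dualCode B C) = weightSeq T ℓ h (dualCode B D) ↔
      weightSeq T ℓ (h + finrank F C) C = weightSeq T ℓ (h + finrank F D) D := by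
  rw [hT.weightSeq_eq_iff, hT.weightSeq_eq_iff, hT.weight_duality hB hR, hT.weight_duality hB hR,
    ← hCD, add_comm h]
  obtain ⟨N, hN⟩ := hT.step_dvd_dim
  rw [mul_comm] at hN
  have himage : ∀ E : Submodule F V,
      {w | ∃ r ∈ Set.Icc 1 (finrank F E), r ≡ finrank F C + h [MOD ℓ] ∧
          w = finrank F V + ℓ - weight T E r} =
        (fun x => finrank F V + ℓ - x) '' {w | ∃ r ∈ Set.Icc 1 (finrank F E),
          r ≡ finrank F C + h [MOD ℓ] ∧ w = weight T E r} := by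
    intro E
    ext w
    constructor
    · rintro ⟨r, hr, hm, rfl⟩
      exact ⟨_, ⟨r, hr, hm, rfl⟩, rfl⟩
    · rintro ⟨_, ⟨r, hr, hm, rfl⟩, rfl⟩
      exact ⟨r, hr, hm, rfl⟩
  -- On multiples of ℓ in [ℓ, ν] the reflection x ↦ ν + ℓ - x is an involution and its subtraction
  -- is not truncated.
  have hsub : ∀ E : Submodule F V, {w | ∃ r ∈ Set.Icc 1 (finrank F E),
      r ≡ finrank F C + h [MOD ℓ] ∧ w = weight T E r} ⊆
        {w | w ∈ Set.Icc ℓ (finrank F V) ∧ ℓ ∣ w} := by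
    rintro E w ⟨r, hr, -, rfl⟩
    obtain ⟨a, ha, -, -, hw⟩ := hT.exists_weight_eq hN hr.1 hr.2
    rw [hw, hN]
    exact ⟨⟨Nat.le_mul_of_pos_left _ a.succ_pos, Nat.mul_le_mul_right _ ha⟩,
      Dvd.intro_left _ rfl⟩
  have hCs := hsub C
  have hDs := hsub D
  have hiC := himage C
  have hiD := himage D
  rw [← hCD] at hDs hiD
  rw [hiC, hiD]
  generalize {w | ∃ r ∈ Set.Icc 1 (finrank F C), r ≡ finrank F C + h [MOD ℓ] ∧
    w = weight T C r} = X at *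
  generalize {w | ∃ r ∈ Set.Icc 1 (finrank F C), r ≡ finrank F C + h [MOD ℓ] ∧
    w = weight T D r} = Y at *
  refine ⟨fun hXY => ?_, fun hXY => by rw [hXY]⟩
  -- A set of weights is recovered from the complement of its reflection, so duality can be
  -- inverted.
  have hmem : ∀ Z ⊆ {w | w ∈ Set.Icc ℓ (finrank F V) ∧ ℓ ∣ w}, ∀ z,
      z ∈ Z ↔ (ℓ ≤ z ∧ z ≤ finrank F V ∧ ℓ ∣ z) ∧ finrank F V + ℓ - z ∉
        {w | w ∈ Set.Icc 1 (finrank F V) ∧ ℓ ∣ w} \ (fun x => finrank F V + ℓ - x) '' Z := by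
    intro Z hZ z
    constructor
    · intro hz
      obtain ⟨⟨h1, h2⟩, h3⟩ := hZ hz
      exact ⟨⟨h1, h2, h3⟩, fun hn => hn.2 ⟨z, hz, rfl⟩⟩
    · rintro ⟨⟨h1, h2, h3⟩, hn⟩
      by_contra hz
      refine hn ⟨⟨⟨?_, ?_⟩, ?_⟩, ?_⟩
      · have := hT.one_le_step
        omega
      · omega
      · exact Nat.dvd_sub (Nat.dvd_add hT.step_dvd_dim dvd_rfl) h3
      · rintro ⟨x, hx, hxz⟩
        obtain ⟨⟨h4, h5⟩, -⟩ := hZ hx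
        have : x = z := by
          simp only at hxz
          omega
        exact hz (this ▸ hx)
  ext z
  rw [hmem X hCs, hmem Y hDs, hXY]

end IsTestFamily

end Duality

/-! ### Coordinate codes -/

section Coordinates

open Module

/-- The positions of the entries of an element of `Space F m n a`. -/
abbrev Pos (m : ℕ) {u : ℕ} (n : Fin u → ℕ) (a : ℕ) : Type :=
  (Σ i : Fin u, Fin (n i) × Fin m) ⊕ Fin a

variable {F : Type*} [Field F] {m u a : ℕ} {n : Fin u → ℕ}

/-- The standard basis of `Space F m n a`, indexed by the positions. -/
def posBasis (F : Type*) [Field F] (m : ℕ) {u : ℕ} (n : Fin u → ℕ) (a : ℕ) :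
    Basis (Pos m n a) F (Space F m n a) :=
  (Pi.basis fun i => Matrix.stdBasis F (Fin (n i)) (Fin m)).prod (Pi.basisFun F (Fin a))

lemma posBasis_inl (i : Fin u) (r : Fin (n i)) (c : Fin m) :
    posBasis F m n a (.inl ⟨i, r, c⟩) = (Pi.single i (Matrix.single r c 1), 0) := by
  rw [posBasis, Basis.prod_apply]
  simp [Pi.basis_apply, Matrix.stdBasis_eq_single]

lemma posBasis_inr (j : Fin a) : posBasis F m n a (.inr j) = (0, Pi.single j 1) := by
  rw [posBasis, Basis.prod_apply]
  simp

lemma posBasis_repr_inl (X : Space F m n a) (i : Fin u) (r : Fin (n i)) (c : Fin m) :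
    (posBasis F m n a).repr X (.inl ⟨i, r, c⟩) = X.1 i r c := by
  rw [posBasis, Basis.prod_repr_inl, Pi.basis_repr]
  simp [Matrix.stdBasis]

lemma posBasis_repr_inr (X : Space F m n a) (j : Fin a) :
    (posBasis F m n a).repr X (.inr j) = X.2 j := by
  rw [posBasis, Basis.prod_repr_inr, Pi.basisFun_repr]

lemma range_posBasis : Set.range (posBasis F m n a) = standardBasis F m n a := by
  ext X
  constructor
  · rintro ⟨⟨i, r, c⟩ | j, rfl⟩
    · exact Or.inl ⟨i, r, c, posBasis_inl i r c⟩
    · exact Or.inr ⟨j, posBasis_inr j⟩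
  · rintro (⟨i, r, c, rfl⟩ | ⟨j, rfl⟩)
    · exact ⟨_, posBasis_inl i r c⟩
    · exact ⟨_, posBasis_inr j⟩

theorem finrank_space :
    finrank F (Space F m n a) = m * ∑ i, n i + a := by
  rw [finrank_eq_card_basis (posBasis F m n a)]
  simp [Finset.mul_sum, mul_comm]

/-- The code of all elements whose entries outside the positions in `S` vanish. -/
def coordCode (F : Type*) [Field F] (S : Finset (Pos m n a)) : Submodule F (Space F m n a) :=
  Submodule.span F (posBasis F m n a '' S)

lemma mem_coordCode {S : Finset (Pos m n a)} {X : Space F m n a} :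
    X ∈ coordCode F S ↔ (∀ i r c, Sum.inl ⟨i, r, c⟩ ∉ S → X.1 i r c = 0) ∧
      ∀ j, Sum.inr j ∉ S → X.2 j = 0 := by
  rw [coordCode, Basis.mem_span_image]
  constructor
  · refine fun h => ⟨fun i r c hS => ?_, fun j hS => ?_⟩
    · by_contra hne
      exact hS (h (by simpa [posBasis_repr_inl] using hne))
    · by_contra hne
      exact hS (h (by simpa [posBasis_repr_inr] using hne))
  · rintro ⟨h1, h2⟩ (⟨i, r, c⟩ | j) hp
    · by_contra hS
      simp [posBasis_repr_inl] at hp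
      exact hp (h1 i r c hS)
    · by_contra hS
      simp [posBasis_repr_inr] at hp
      exact hp (h2 j hS)

lemma finrank_coordCode (S : Finset (Pos m n a)) : finrank F (coordCode F S) = S.card := by
  classical
  have := finrank_span_finset_eq_card (R := F) (s := S.image (posBasis F m n a)) (by
    rw [Finset.coe_image]
    exact (posBasis F m n a).linearIndependent.linearIndepOn_id.mono (Set.image_subset_range _ _))
  rw [Finset.coe_image, Finset.card_image_of_injective _ (posBasis F m n a).injective] at this
  exact this

lemma exists_span_eq_coordCode {S : Set (Space F m n a)} (hS : S ⊆ standardBasis F m n a) :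
    ∃ S' : Finset (Pos m n a), Submodule.span F S = coordCode F S' := by
  classical
  refine ⟨Finset.univ.filter fun p => posBasis F m n a p ∈ S, ?_⟩
  rw [coordCode]
  congr 1
  ext X
  constructor
  · intro hX
    obtain ⟨p, rfl⟩ : X ∈ Set.range (posBasis F m n a) := by rw [range_posBasis]; exact hS hX
    exact ⟨p, by simpa using hX, rfl⟩
  · rintro ⟨p, hp, rfl⟩
    simpa using hp

lemma card_eq_sum_ite (S : Finset (Pos m n a)) :
    S.card = ∑ i, ∑ r, ∑ c, (if Sum.inl ⟨i, r, c⟩ ∈ S then 1 else 0) +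
      ∑ j, (if Sum.inr j ∈ S then 1 else 0) := by
  have : S.card = ∑ p, if p ∈ S then 1 else 0 := by simp
  rw [this, Fintype.sum_sum_type, Fintype.sum_sigma]
  simp only [Fintype.sum_prod_type]

/-- In each matrix block, `S` consists of full rows, or of full columns of length `m`. -/
def LineClosed (S : Finset (Pos m n a)) : Prop :=
  ∀ i, (∀ r c c', Sum.inl ⟨i, r, c⟩ ∈ S → Sum.inl ⟨i, r, c'⟩ ∈ S) ∨
    (n i = m ∧ ∀ r r' c, Sum.inl ⟨i, r, c⟩ ∈ S → Sum.inl ⟨i, r', c⟩ ∈ S)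

end Coordinates

/-! ### Marked cells on the graphs of injections -/

section Grid

variable {F : Type*} [Field F]

lemma exists_perm_apply_eq {α : Type*} [DecidableEq α] {x y x' y' : α} (h : x ≠ y) (h' : x' ≠ y') :
    ∃ π : Equiv.Perm α, π x = x' ∧ π y = y' := by
  refine ⟨(Equiv.swap x x').trans (Equiv.swap (Equiv.swap x x' y) y'), ?_, ?_⟩
  · rw [Equiv.trans_apply, Equiv.swap_apply_left]
    refine Equiv.swap_apply_of_ne_of_ne (fun e => h ?_) h'
    exact (Equiv.swap x x').injective (by rw [Equiv.swap_apply_left]; exact e)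
  · simp

/-- If the number of marked cells on the graph of an injection from rows to columns does not depend
on the injection, then the marked cells form full rows or full columns. -/
lemma rows_or_columns_of_card_graph {k m : ℕ} (hkm : k ≤ m) (g : Fin k → Fin m → Prop)
    [∀ r c, Decidable (g r c)]
    (hg : ∀ f f' : Fin k → Fin m, f.Injective → f'.Injective →
      ∑ r, (if g r (f r) then 1 else 0) = ∑ r, if g r (f' r) then 1 else 0) :
    (∀ r c c', g r c → g r c') ∨ (k = m ∧ ∀ r r' c, g r c → g r' c) := by
  have hinj := Fin.castLE_injective hkm
  rcases hkm.lt_or_eq with hlt | rfl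
  · left
    intro r c c' hc
    by_contra hc'
    have hne : c ≠ c' := by rintro rfl; exact hc' hc
    -- As k < m, some injection sends `r` to `c` and misses `c'`. Swapping the two columns then
    -- moves only the cell in row `r`.
    obtain ⟨π, h1, h2⟩ := exists_perm_apply_eq (x := Fin.castLE hkm r) (y := ⟨k, hlt⟩)
      (by simp [Fin.ext_iff]; omega) hne
    have := hg (fun s => π (Fin.castLE hkm s)) (fun s => Equiv.swap c c' (π (Fin.castLE hkm s)))
      (π.injective.comp hinj) ((Equiv.swap c c').injective.comp (π.injective.comp hinj))
    rw [← Finset.add_sum_erase _ _ (Finset.mem_univ r),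
      ← Finset.add_sum_erase _ _ (Finset.mem_univ r)] at this
    simp only [h1, Equiv.swap_apply_left, if_pos hc, if_neg hc'] at this
    have h3 : ∑ s ∈ Finset.univ.erase r, (if g s (π (Fin.castLE hkm s)) then 1 else 0) =
        ∑ s ∈ Finset.univ.erase r,
          if g s (Equiv.swap c c' (π (Fin.castLE hkm s))) then 1 else 0 := by
      refine Finset.sum_congr rfl fun s hs => ?_
      rw [Equiv.swap_apply_of_ne_of_ne]
      · rw [← h1]
        exact fun e => (Finset.ne_of_mem_erase hs) (hinj (π.injective e))
      · rw [← h2]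
        intro e
        have := congrArg Fin.val (π.injective e)
        simp at this
        omega
    omega
  · have hsq : ∀ r r' c c', r ≠ r' → c ≠ c' →
        (if g r c then 1 else 0) + (if g r' c' then 1 else 0) =
          (if g r c' then 1 else 0) + if g r' c then 1 else 0 := by
      intro r r' c c' hr hc
      obtain ⟨π, h1, h2⟩ := exists_perm_apply_eq hr hc
      have := hg π (fun s => Equiv.swap c c' (π s)) π.injective
        ((Equiv.swap c c').injective.comp π.injective)
      have hr' : r' ∈ Finset.univ.erase r := Finset.mem_erase.2 ⟨hr.symm, Finset.mem_univ _⟩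
      rw [← Finset.add_sum_erase _ _ (Finset.mem_univ r), ← Finset.add_sum_erase _ _ hr',
        ← Finset.add_sum_erase _ _ (Finset.mem_univ r), ← Finset.add_sum_erase _ _ hr'] at this
      simp only [h1, h2, Equiv.swap_apply_left, Equiv.swap_apply_right] at this
      have h3 : ∑ s ∈ (Finset.univ.erase r).erase r', (if g s (π s) then 1 else 0) =
          ∑ s ∈ (Finset.univ.erase r).erase r', if g s (Equiv.swap c c' (π s)) then 1 else 0 := by
        refine Finset.sum_congr rfl fun s hs => ?_
        simp only [Finset.mem_erase] at hs
        rw [Equiv.swap_apply_of_ne_of_ne]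
        · rw [← h1]
          exact fun e => hs.2.1 (π.injective e)
        · rw [← h2]
          exact fun e => hs.1 (π.injective e)
      omega
    by_contra! hcon
    obtain ⟨⟨r, c, c', h1, h2⟩, h3⟩ := hcon
    obtain ⟨r₁, r₂, c₁, h4, h5⟩ := h3 rfl
    have hc : c ≠ c' := by rintro rfl; exact h2 h1
    have hr : r₁ ≠ r₂ := by rintro rfl; exact h5 h4
    -- A row that is not constant forces column `c` to be full and `c'` to be empty. Comparing any
    -- other column with `c` then makes that column constant.
    have hcol : ∀ s, g s c ∧ ¬ g s c' := by
      intro s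
      by_cases hs : r = s
      · subst hs; exact ⟨h1, h2⟩
      · have := hsq r s c c' hs hc
        rw [if_pos h1, if_neg h2] at this
        split_ifs at this with h6 h7 <;> first | omega | exact ⟨h7, h6⟩ | skip
        all_goals simp_all
    have hc₁ : c₁ ≠ c := by rintro rfl; exact h5 (hcol r₂).1
    have := hsq r₁ r₂ c₁ c hr hc₁
    rw [if_pos h4, if_neg h5, if_pos (hcol r₁).1, if_pos (hcol r₂).1] at this
    omega

lemma rank_le_card_of_rows {k m : ℕ} (X : Matrix (Fin k) (Fin m) F) (R : Finset (Fin k))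
    (h : ∀ r ∉ R, ∀ c, X r c = 0) : X.rank ≤ R.card := by
  refine X.rank_le_card_of_support_subset R fun r hr => ?_
  by_contra hR
  exact hr (funext (h r hR))

lemma rank_le_card_of_cols {k m : ℕ} (X : Matrix (Fin k) (Fin m) F) (R : Finset (Fin m))
    (h : ∀ c ∉ R, ∀ r, X r c = 0) : X.rank ≤ R.card := by
  rw [← Matrix.rank_transpose]
  exact rank_le_card_of_rows _ R h

/-- The marked cells of the graph sit in distinct rows and columns, so they cut out an identity
submatrix. -/
lemma card_le_rank_graph {k m : ℕ} (g : Fin k → Fin m → Prop) [∀ r c, Decidable (g r c)]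
    {f : Fin k → Fin m} (hf : f.Injective) :
    ∑ r, (if g r (f r) then 1 else 0) ≤
      (Matrix.of fun r c => if f r = c ∧ g r c then (1 : F) else 0).rank := by
  set X : Matrix (Fin k) (Fin m) F := Matrix.of fun r c => if f r = c ∧ g r c then (1 : F) else 0
    with hX
  have h := Matrix.rank_submatrix_le X (fun r : {r // g r (f r)} => r.1)
    (fun r : {r // g r (f r)} => f r.1)
  have h1 : X.submatrix (fun r : {r // g r (f r)} => r.1)
      (fun r : {r // g r (f r)} => f r.1) = 1 := by
    ext r s
    rw [Matrix.submatrix_apply, Matrix.one_apply, hX, Matrix.of_apply]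
    refine if_congr ?_ rfl rfl
    constructor
    · exact fun e => Subtype.ext (hf e.1)
    · rintro rfl
      exact ⟨rfl, r.2⟩
  rw [h1, Matrix.rank_one, Fintype.card_subtype, Finset.card_filter] at h
  exact h

end Grid

/-! ### Coordinate codes that are optimal anticodes -/

section Anticode

open Module

variable {F : Type*} [Field F] {m u a : ℕ} {n : Fin u → ℕ}

lemma hammingNorm_eq_sum {x : Fin a → F} [∀ j, Decidable (x j ≠ 0)] [DecidableEq F] :
    hammingNorm x = ∑ j, if x j ≠ 0 then 1 else 0 := by
  rw [hammingNorm, Finset.card_filter]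
  exact Finset.sum_congr rfl fun j _ => by congr

/-- The rank of a block is at most the number of its full rows (or columns) in `S`, and each of
these has m cells. -/
lemma anticodeWeight_le_card {S : Finset (Pos m n a)} (hS : LineClosed S) {X : Space F m n a}
    (hX : X ∈ coordCode F S) : anticodeWeight X ≤ S.card := by
  classical
  obtain ⟨h1, h2⟩ := mem_coordCode.1 hX
  rw [card_eq_sum_ite, anticodeWeight]
  refine Nat.add_le_add (Finset.sum_le_sum fun i _ => ?_) ?_
  · rcases hS i with h | ⟨hn, h⟩
    · rcases Nat.eq_zero_or_pos m with rfl | hm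
      · simp
      have hr := rank_le_card_of_rows (X.1 i)
        (Finset.univ.filter fun r => Sum.inl ⟨i, r, ⟨0, hm⟩⟩ ∈ S)
        (fun r hr c => h1 i r c fun hc => hr (by simpa using h r c _ hc))
      rw [Finset.card_filter] at hr
      refine (Nat.mul_le_mul_left m hr).trans (le_of_eq ?_)
      rw [Finset.mul_sum]
      refine Finset.sum_congr rfl fun r _ => ?_
      rw [Finset.sum_congr rfl fun c _ => if_congr (Iff.intro (h r c ⟨0, hm⟩) (h r _ c)) rfl rfl]
      simp
    · rcases Nat.eq_zero_or_pos m with rfl | hm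
      · simp
      have hr := rank_le_card_of_cols (X.1 i)
        (Finset.univ.filter fun c => Sum.inl ⟨i, ⟨0, hn.symm ▸ hm⟩, c⟩ ∈ S)
        (fun c hc r => h1 i r c fun hr => hc (by simpa using h r _ c hr))
      rw [Finset.card_filter] at hr
      refine (Nat.mul_le_mul_left m hr).trans (le_of_eq ?_)
      rw [Finset.mul_sum, Finset.sum_comm]
      refine Finset.sum_congr rfl fun c _ => ?_
      rw [Finset.sum_congr rfl fun r _ => if_congr
        (Iff.intro (h r ⟨0, hn.symm ▸ hm⟩ c) (h _ r c)) rfl rfl]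
      simp [hn]
  · rw [hammingNorm_eq_sum]
    refine Finset.sum_le_sum fun j _ => ?_
    by_cases hj : Sum.inr j ∈ S
    · rw [if_pos hj]; split_ifs <;> simp
    · simp [h2 j hj]

/-- The element of `coordCode S` with ones at the positions of `S` on the graphs of the `f i` and
in the Hamming part. -/
def graphPoint (F : Type*) [Field F] (S : Finset (Pos m n a)) (f : ∀ i, Fin (n i) → Fin m) :
    Space F m n a :=
  (fun i => Matrix.of fun r c => if f i r = c ∧ Sum.inl ⟨i, r, c⟩ ∈ S then 1 else 0,
    fun j => if Sum.inr j ∈ S then 1 else 0)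

lemma graphPoint_mem (S : Finset (Pos m n a)) (f : ∀ i, Fin (n i) → Fin m) :
    graphPoint F S f ∈ coordCode F S := by
  rw [mem_coordCode]
  refine ⟨fun i r c h => ?_, fun j h => ?_⟩
  · simp [graphPoint, h]
  · simp [graphPoint, h]

lemma le_anticodeWeight_graphPoint (S : Finset (Pos m n a)) {f : ∀ i, Fin (n i) → Fin m}
    (hf : ∀ i, (f i).Injective) :
    ∑ i, m * ∑ r, (if Sum.inl ⟨i, r, f i r⟩ ∈ S then 1 else 0) +
      ∑ j, (if Sum.inr j ∈ S then 1 else 0) ≤ anticodeWeight (graphPoint F S f) := by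
  classical
  rw [anticodeWeight, hammingNorm_eq_sum]
  refine Nat.add_le_add (Finset.sum_le_sum fun i _ => Nat.mul_le_mul_left _ ?_)
    (Finset.sum_le_sum fun j _ => ?_)
  · exact card_le_rank_graph (F := F) (fun r c => Sum.inl ⟨i, r, c⟩ ∈ S) (hf i)
  · simp [graphPoint]

/-- The graph meets each row once, and each column once when the block is square. Each hit in `S`
thus accounts for one full line of m cells. -/
lemma LineClosed.sum_graph {S : Finset (Pos m n a)} (hS : LineClosed S)
    {f : ∀ i, Fin (n i) → Fin m} (hf : ∀ i, (f i).Injective) :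
    ∑ i, m * ∑ r, (if Sum.inl ⟨i, r, f i r⟩ ∈ S then 1 else 0) =
      ∑ i, ∑ r, ∑ c, if Sum.inl ⟨i, r, c⟩ ∈ S then 1 else 0 := by
  refine Finset.sum_congr rfl fun i _ => ?_
  rcases hS i with h | ⟨hn, h⟩
  · rw [Finset.mul_sum]
    refine Finset.sum_congr rfl fun r _ => ?_
    rw [Finset.sum_congr rfl fun c _ => if_congr (Iff.intro (h r c (f i r)) (h r _ c)) rfl rfl]
    simp
  · have hb : (f i).Bijective :=
      (Fintype.bijective_iff_injective_and_card _).2 ⟨hf i, by simp [hn]⟩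
    rw [Finset.sum_comm, ← hb.sum_comp, Finset.mul_sum]
    refine Finset.sum_congr rfl fun r _ => ?_
    rw [Finset.sum_congr rfl fun r' _ => if_congr (Iff.intro (h r' r (f i r)) (h r r' _)) rfl rfl]
    simp [hn]

theorem LineClosed.isOptimalAnticode {S : Finset (Pos m n a)} (hn : ∀ i, n i ≤ m)
    (hS : LineClosed S) : IsOptimalAnticode (coordCode F S) := by
  rw [IsOptimalAnticode, finrank_coordCode]
  constructor
  · refine ⟨graphPoint F S fun i => Fin.castLE (hn i), graphPoint_mem _ _, le_antisymm ?_ ?_⟩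
    · rw [card_eq_sum_ite, ← hS.sum_graph fun i => Fin.castLE_injective (hn i)]
      exact le_anticodeWeight_graphPoint S fun i => Fin.castLE_injective (hn i)
    · exact anticodeWeight_le_card hS (graphPoint_mem _ _)
  · rintro w ⟨X, hX, rfl⟩
    exact anticodeWeight_le_card hS hX

theorem lineClosed_of_isOptimalAnticode {S : Finset (Pos m n a)} (hm : 1 ≤ m)
    (hn : ∀ i, n i ≤ m) (hS : IsOptimalAnticode (coordCode F S)) : LineClosed S := by
  classical
  have : NeZero m := ⟨by omega⟩
  rw [IsOptimalAnticode, finrank_coordCode] at hS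
  have hle : ∀ f : ∀ i, Fin (n i) → Fin m, (∀ i, (f i).Injective) →
      ∑ i, m * ∑ r, (if Sum.inl ⟨i, r, f i r⟩ ∈ S then 1 else 0) ≤
        ∑ i, ∑ r, ∑ c, if Sum.inl ⟨i, r, c⟩ ∈ S then 1 else 0 := by
    intro f hf
    have h1 := le_anticodeWeight_graphPoint (F := F) S hf
    have h2 := hS.2 ⟨_, graphPoint_mem S f, rfl⟩
    have h3 := card_eq_sum_ite S
    omega
  have heq : ∀ f : ∀ i, Fin (n i) → Fin m, (∀ i, (f i).Injective) →
      ∑ i, m * ∑ r, (if Sum.inl ⟨i, r, f i r⟩ ∈ S then 1 else 0) =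
        ∑ i, ∑ r, ∑ c, if Sum.inl ⟨i, r, c⟩ ∈ S then 1 else 0 := by
    intro f hf
    -- The m cyclic shifts of the graphs cover every cell exactly once. Summing `hle` over the
    -- shifts gives an equality, so `hle` is an equality for each shift, in particular for d = 0.
    have hsum : ∑ d : Fin m, ∑ i, m * ∑ r, (if Sum.inl ⟨i, r, f i r + d⟩ ∈ S then 1 else 0) =
        ∑ d : Fin m, ∑ i, ∑ r, ∑ c, if Sum.inl ⟨i, r, c⟩ ∈ S then 1 else 0 := by
      rw [Finset.sum_comm, Finset.sum_const, Finset.card_univ, Fintype.card_fin, smul_eq_mul,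
        Finset.mul_sum]
      refine Finset.sum_congr rfl fun i _ => ?_
      rw [← Finset.mul_sum, Finset.sum_comm]
      congr 1
      refine Finset.sum_congr rfl fun r _ => ?_
      exact Equiv.sum_comp (Equiv.addLeft (f i r)) fun c => if Sum.inl ⟨i, r, c⟩ ∈ S then 1 else 0
    have := (Finset.sum_eq_sum_iff_of_le fun d _ => hle (fun i r => f i r + d)
      fun i => (add_left_injective d).comp (hf i)).1 hsum 0 (Finset.mem_univ _)
    simpa using this
  intro i
  refine rows_or_columns_of_card_graph (hn i) (fun r c => Sum.inl ⟨i, r, c⟩ ∈ S) fun f f' hf hf' => ?_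
  -- Varying the injection in block `i` alone isolates the count in that block.
  have hupd : ∀ h : Fin (n i) → Fin m, h.Injective →
      m * ∑ r, (if Sum.inl ⟨i, r, h r⟩ ∈ S then 1 else 0) +
        ∑ j ∈ Finset.univ.erase i, m * ∑ r,
          (if Sum.inl ⟨j, r, Fin.castLE (hn j) r⟩ ∈ S then 1 else 0) =
        ∑ i, ∑ r, ∑ c, if Sum.inl ⟨i, r, c⟩ ∈ S then 1 else 0 := by
    intro h hh
    rw [← heq (Function.update (fun j => Fin.castLE (hn j)) i h),
      ← Finset.add_sum_erase _ _ (Finset.mem_univ i)]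
    · congr 1
      · simp
      · refine Finset.sum_congr rfl fun j hj => ?_
        rw [Function.update_of_ne (Finset.ne_of_mem_erase hj)]
    · intro j
      rcases eq_or_ne j i with rfl | hj
      · simpa using hh
      · rw [Function.update_of_ne hj]
        exact Fin.castLE_injective (hn j)
  have h1 := hupd f hf
  have h2 := hupd f' hf'
  exact Nat.eq_of_mul_eq_mul_left (show 0 < m by omega) (by omega)

end Anticode

/-! ### Removing a line of positions -/

section Chains

variable {m u a : ℕ} {n : Fin u → ℕ}

lemma LineClosed.compl {S : Finset (Pos m n a)} (hS : LineClosed S) : LineClosed Sᶜ := by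
  intro i
  simp only [Finset.mem_compl]
  rcases hS i with h | ⟨hn, h⟩
  · exact Or.inl fun r c c' h1 h2 => h1 (h r c' c h2)
  · exact Or.inr ⟨hn, fun r r' c h1 h2 => h1 (h r' r c h2)⟩

/-- A full row has m cells, and so has a full column when it is needed, since its block is square.
If no matrix cell is left, any m Hamming positions can be dropped. -/
lemma LineClosed.exists_subset {S : Finset (Pos m n a)} (hS : LineClosed S) (hm : m ≤ S.card) :
    ∃ S' ⊆ S, LineClosed S' ∧ S'.card + m = S.card := by
  classical
  by_cases hex : ∃ i r c, Sum.inl ⟨i, r, c⟩ ∈ S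
  · obtain ⟨i, r, c, hp⟩ := hex
    rcases hS i with h | ⟨hn, h⟩
    · set L : Finset (Pos m n a) := Finset.univ.image fun c' : Fin m => Sum.inl ⟨i, r, c'⟩ with hL
      have hLS : L ⊆ S := by
        intro p hp'
        obtain ⟨c', -, rfl⟩ := Finset.mem_image.1 hp'
        exact h r c c' hp
      have hcard : L.card = m := by
        rw [hL, Finset.card_image_of_injective _ fun x y hxy => by simpa using hxy]
        simp
      refine ⟨S \ L, Finset.sdiff_subset, fun j => ?_, ?_⟩
      · rcases hS j with h' | ⟨hn', h'⟩
        · refine Or.inl fun r₁ c₁ c₂ h₁ => ?_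
          rw [Finset.mem_sdiff] at h₁ ⊢
          refine ⟨h' _ _ _ h₁.1, fun h₂ => h₁.2 ?_⟩
          obtain ⟨c', -, e⟩ := Finset.mem_image.1 h₂
          have e' := Sum.inl.inj e
          obtain rfl : i = j := congrArg Sigma.fst e'
          obtain rfl : r = r₁ := by simpa using (congrArg Prod.fst (eq_of_heq (Sigma.mk.inj e').2))
          exact Finset.mem_image.2 ⟨c₁, Finset.mem_univ _, rfl⟩
        -- Removing a row may destroy column closure, so block `i` keeps the row alternative even if
        -- it also satisfies the other one.
        · rcases eq_or_ne j i with rfl | hne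
          · refine Or.inl fun r₁ c₁ c₂ h₁ => ?_
            rw [Finset.mem_sdiff] at h₁ ⊢
            refine ⟨h _ _ _ h₁.1, fun h₂ => h₁.2 ?_⟩
            obtain ⟨c', -, e⟩ := Finset.mem_image.1 h₂
            have e' := Sum.inl.inj e
            obtain rfl : r = r₁ := by
              simpa using (congrArg Prod.fst (eq_of_heq (Sigma.mk.inj e').2))
            exact Finset.mem_image.2 ⟨c₁, Finset.mem_univ _, rfl⟩
          · refine Or.inr ⟨hn', fun r₁ r₂ c₁ h₁ => ?_⟩
            rw [Finset.mem_sdiff] at h₁ ⊢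
            refine ⟨h' _ _ _ h₁.1, fun h₂ => ?_⟩
            obtain ⟨c', -, e⟩ := Finset.mem_image.1 h₂
            exact hne (congrArg Sigma.fst (Sum.inl.inj e)).symm
      · rw [Finset.card_sdiff_of_subset hLS, hcard]
        omega
    · set L : Finset (Pos m n a) := Finset.univ.image fun r' => Sum.inl ⟨i, r', c⟩ with hL
      have hLS : L ⊆ S := by
        intro p hp'
        obtain ⟨r', -, rfl⟩ := Finset.mem_image.1 hp'
        exact h r r' c hp
      have hcard : L.card = m := by
        rw [hL, Finset.card_image_of_injective _ fun x y hxy => by simpa using hxy]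
        simpa using hn
      refine ⟨S \ L, Finset.sdiff_subset, fun j => ?_, ?_⟩
      · rcases eq_or_ne j i with rfl | hne
        · refine Or.inr ⟨hn, fun r₁ r₂ c₁ h₁ => ?_⟩
          rw [Finset.mem_sdiff] at h₁ ⊢
          refine ⟨h _ _ _ h₁.1, fun h₂ => h₁.2 ?_⟩
          obtain ⟨r', -, e⟩ := Finset.mem_image.1 h₂
          have e' := Sum.inl.inj e
          obtain rfl : c = c₁ := by simpa using (congrArg Prod.snd (eq_of_heq (Sigma.mk.inj e').2))
          exact Finset.mem_image.2 ⟨r₁, Finset.mem_univ _, rfl⟩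
        · have hout : ∀ r₂ c₂, Sum.inl ⟨j, r₂, c₂⟩ ∉ L := by
            intro r₂ c₂ h₂
            obtain ⟨r', -, e⟩ := Finset.mem_image.1 h₂
            exact hne (congrArg Sigma.fst (Sum.inl.inj e)).symm
          rcases hS j with h' | ⟨hn', h'⟩
          · refine Or.inl fun r₁ c₁ c₂ h₁ => ?_
            rw [Finset.mem_sdiff] at h₁ ⊢
            exact ⟨h' _ _ _ h₁.1, hout _ _⟩
          · refine Or.inr ⟨hn', fun r₁ r₂ c₁ h₁ => ?_⟩
            rw [Finset.mem_sdiff] at h₁ ⊢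
            exact ⟨h' _ _ _ h₁.1, hout _ _⟩
      · rw [Finset.card_sdiff_of_subset hLS, hcard]
        omega
  · push Not at hex
    obtain ⟨S', hS', hc⟩ := Finset.exists_subset_card_eq (show S.card - m ≤ S.card by omega)
    exact ⟨S', hS', fun i => Or.inl fun r c c' h => absurd (hS' h) (hex i r c), by omega⟩

end Chains

/-! ### Spaces of matrices of rank at most one -/

section RankOne

open Module Matrix

variable {F : Type*} [Field F] {k m : ℕ}

lemma one_le_rank {X : Matrix (Fin k) (Fin m) F} (hX : X ≠ 0) : 1 ≤ X.rank := by
  rw [Nat.one_le_iff_ne_zero, rank_eq_finrank_span_cols, Ne, Submodule.finrank_eq_zero]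
  intro h
  refine hX (Matrix.ext fun r c => ?_)
  have : X.col c ∈ Submodule.span F (Set.range X.col) := Submodule.subset_span ⟨c, rfl⟩
  rw [h, Submodule.mem_bot] at this
  exact congrFun this r

lemma exists_eq_vecMulVec {X : Matrix (Fin k) (Fin m) F} (hX : X.rank ≤ 1) :
    ∃ v w, X = vecMulVec v w := by
  rw [rank_eq_finrank_span_cols, finrank_le_one_iff] at hX
  obtain ⟨v, hv⟩ := hX
  choose w hw using fun c => hv ⟨X.col c, Submodule.subset_span ⟨c, rfl⟩⟩
  refine ⟨v, w, Matrix.ext fun r c => ?_⟩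
  have := congrFun (congrArg Subtype.val (hw c)) r
  simp only [Submodule.coe_smul, Pi.smul_apply, smul_eq_mul, col_apply] at this
  rw [vecMulVec_apply, ← this, mul_comm]

/-- Functionals separating the independent vectors `v₀` and `v₁`, applied to the columns of the sum,
show that `w₀` and `w₁` are both multiples of one row. -/
lemma mem_span_of_rank_le_one {v₀ v₁ : Fin k → F} {w₀ w₁ : Fin m → F} (hv₀ : v₀ ≠ 0)
    (hw₀ : w₀ ≠ 0) (hv : v₁ ∉ Submodule.span F {v₀})
    (h : (vecMulVec v₀ w₀ + vecMulVec v₁ w₁).rank ≤ 1) : w₁ ∈ Submodule.span F {w₀} := by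
  obtain ⟨v, w, hvw⟩ := exists_eq_vecMulVec h
  have hcol : ∀ (f : (Fin k → F) →ₗ[F] F) c, w₀ c * f v₀ + w₁ c * f v₁ = w c * f v := by
    intro f c
    have h1 : w₀ c • v₀ + w₁ c • v₁ = w c • v := by
      ext r
      have := congrFun (congrFun hvw r) c
      simp only [Matrix.add_apply, vecMulVec_apply] at this
      simp only [Pi.add_apply, Pi.smul_apply, smul_eq_mul]
      linear_combination this
    simpa using congrArg f h1
  have hv' : v₀ ∉ Submodule.span F {v₁} := by
    intro hmem
    obtain ⟨d, rfl⟩ := Submodule.mem_span_singleton.1 hmem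
    have hd : d ≠ 0 := by rintro rfl; simp at hv₀
    exact hv (Submodule.mem_span_singleton.2 ⟨d⁻¹, by rw [smul_smul, inv_mul_cancel₀ hd, one_smul]⟩)
  obtain ⟨f, hf, hf0⟩ := Submodule.exists_le_ker_of_notMem hv
  obtain ⟨g, hg, hg0⟩ := Submodule.exists_le_ker_of_notMem hv'
  have hf0' : f v₀ = 0 := hf0 (Submodule.mem_span_singleton_self v₀)
  have hg0' : g v₁ = 0 := hg0 (Submodule.mem_span_singleton_self v₁)
  have hgv : g v ≠ 0 := by
    intro h0
    refine hw₀ (funext fun c => ?_)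
    have := hcol g c
    rw [hg0', h0] at this
    simpa [hg] using this
  refine Submodule.mem_span_singleton.2 ⟨f v * g v₀ / (f v₁ * g v), funext fun c => ?_⟩
  have h1 := hcol f c
  have h2 := hcol g c
  rw [hf0'] at h1
  rw [hg0'] at h2
  simp only [Pi.smul_apply, smul_eq_mul]
  field_simp
  linear_combination f v * h2 - g v * h1

/-- A space of matrices of rank at most one has a common column or a common row. -/
theorem exists_common_of_rank_le_one (L : Submodule F (Matrix (Fin k) (Fin m) F))
    (hL : ∀ X ∈ L, X.rank ≤ 1) :
    (∃ v, ∀ X ∈ L, ∃ w, X = vecMulVec v w) ∨ ∃ w, ∀ X ∈ L, ∃ v, X = vecMulVec v w := by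
  by_cases h0 : ∀ X ∈ L, X = 0
  · exact Or.inl ⟨0, fun X hX => ⟨0, by rw [h0 X hX]; ext; simp [vecMulVec_apply]⟩⟩
  push Not at h0
  obtain ⟨X₀, hX₀, hne⟩ := h0
  obtain ⟨v₀, w₀, rfl⟩ := exists_eq_vecMulVec (hL X₀ hX₀)
  obtain ⟨hv₀, hw₀⟩ : v₀ ≠ 0 ∧ w₀ ≠ 0 := by
    constructor <;> rintro rfl <;> exact hne (by ext; simp [vecMulVec_apply])
  by_contra! hcon
  obtain ⟨hc₁, hc₂⟩ := hcon
  obtain ⟨X₁, hX₁, hne₁⟩ := hc₁ v₀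
  obtain ⟨X₂, hX₂, hne₂⟩ := hc₂ w₀
  obtain ⟨v₁, w₁, rfl⟩ := exists_eq_vecMulVec (hL X₁ hX₁)
  obtain ⟨v₂, w₂, rfl⟩ := exists_eq_vecMulVec (hL X₂ hX₂)
  have hv₁ : v₁ ∉ Submodule.span F {v₀} := by
    intro hmem
    obtain ⟨d, rfl⟩ := Submodule.mem_span_singleton.1 hmem
    exact hne₁ (d • w₁) (by ext; simp [vecMulVec_apply]; ring)
  have hw₂ : w₂ ∉ Submodule.span F {w₀} := by
    intro hmem
    obtain ⟨d, rfl⟩ := Submodule.mem_span_singleton.1 hmem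
    exact hne₂ (d • v₂) (by ext; simp [vecMulVec_apply]; ring)
  have hw₁0 : w₁ ≠ 0 := by
    rintro rfl
    exact hne₁ 0 (by ext; simp [vecMulVec_apply])
  have hv₂0 : v₂ ≠ 0 := by
    rintro rfl
    exact hne₂ 0 (by ext; simp [vecMulVec_apply])
  have h1 := mem_span_of_rank_le_one hv₀ hw₀ hv₁ (hL _ (L.add_mem hX₀ hX₁))
  have h2 := mem_span_of_rank_le_one hw₀ hv₀ hw₂ (by
    rw [← rank_transpose, transpose_add, transpose_vecMulVec, transpose_vecMulVec]
    exact hL _ (L.add_mem hX₀ hX₂))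
  obtain ⟨c, rfl⟩ := Submodule.mem_span_singleton.1 h1
  obtain ⟨d, rfl⟩ := Submodule.mem_span_singleton.1 h2
  have hw₂0 : w₂ ≠ 0 := by
    rintro rfl
    exact hw₂ (Submodule.zero_mem _)
  -- `X₁` now has row direction `w₀` and `X₂` has column direction `v₀`. Their sum has rank at most
  -- one too, which forces `w₂` parallel to `w₀`.
  have h3 : c • w₀ ∈ Submodule.span F {w₂} := by
    refine mem_span_of_rank_le_one hv₂0 hw₂0 ?_ (hL _ (L.add_mem hX₂ hX₁))
    intro hmem
    refine hv₁ (Submodule.span_le.2 ?_ hmem)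
    rintro _ rfl
    exact h2
  obtain ⟨e, he⟩ := Submodule.mem_span_singleton.1 h3
  have he0 : e ≠ 0 := by
    rintro rfl
    exact hw₁0 (by rw [← he, zero_smul])
  refine hw₂ (Submodule.mem_span_singleton.2 ⟨e⁻¹ * c, ?_⟩)
  rw [mul_smul, ← he, smul_smul, inv_mul_cancel₀ he0, one_smul]

end RankOne

/-! ### Sum-rank weight and spaces of weight at most one -/

section Weight

open Module Matrix

variable {F : Type*} [Field F] {m u a : ℕ} {n : Fin u → ℕ}

open Classical in
/-- The sum-rank weight. -/
def srkWeight (X : Space F m n a) : ℕ := ∑ i, (X.1 i).rank + hammingNorm X.2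

lemma srkDist_eq (X Y : Space F m n a) : srkDist X Y = srkWeight (X - Y) := by
  classical
  simp [srkDist, srkWeight, hammingDist, hammingNorm, sub_eq_zero]

lemma anticodeWeight_eq (X : Space F m n a) :
    anticodeWeight X = m * srkWeight ((X.1, 0) : Space F m n a) +
      srkWeight ((0, X.2) : Space F m n a) := by
  classical
  simp [srkWeight, anticodeWeight, Finset.mul_sum]

/-- The component of `X` with index `p` is nonzero. -/
def CompNe (X : Space F m n a) : Fin u ⊕ Fin a → Prop :=
  Sum.elim (fun i => X.1 i ≠ 0) (fun j => X.2 j ≠ 0)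

lemma two_le_srkWeight {X : Space F m n a} {p q : Fin u ⊕ Fin a} (hpq : p ≠ q)
    (hp : CompNe X p) (hq : CompNe X q) : 2 ≤ srkWeight X := by
  classical
  set wt : Fin u ⊕ Fin a → ℕ := Sum.elim (fun i => (X.1 i).rank) (fun j => if X.2 j ≠ 0 then 1 else 0)
    with hwt
  have h1 : srkWeight X = ∑ p, wt p := by
    rw [Fintype.sum_sum_type, srkWeight, hammingNorm_eq_sum]
    rfl
  have h2 : ∀ p, CompNe X p → 1 ≤ wt p := by
    rintro (i | j) h
    · exact one_le_rank h
    · have h' : X.2 j ≠ 0 := h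
      simp [hwt, h']
  rw [h1, ← Finset.add_sum_erase _ _ (Finset.mem_univ p),
    ← Finset.add_sum_erase _ _ (Finset.mem_erase.2 ⟨hpq.symm, Finset.mem_univ q⟩)]
  have := h2 p hp
  have := h2 q hq
  omega

lemma compNe_add {X Y : Space F m n a} {p : Fin u ⊕ Fin a} (hX : CompNe X p) (hY : ¬ CompNe Y p) :
    CompNe (X + Y) p := by
  rcases p with i | j <;> simp only [CompNe, Sum.elim_inl, Sum.elim_inr, not_not] at * <;>
    simpa [hY] using hX

lemma exists_compNe {X : Space F m n a} (hX : X ≠ 0) : ∃ p, CompNe X p := by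
  by_contra! h
  refine hX (Prod.ext (funext fun i => ?_) (funext fun j => ?_))
  · simpa [CompNe] using h (.inl i)
  · simpa [CompNe] using h (.inr j)

lemma eq_zero_of_srkWeight_eq_zero {X : Space F m n a} (hX : srkWeight X = 0) : X = 0 := by
  classical
  have h := Nat.add_eq_zero_iff.1 hX
  refine Prod.ext (funext fun i => ?_) (hammingNorm_eq_zero.1 h.2)
  by_contra hne
  have h1 : 1 ≤ (X.1 i).rank := one_le_rank hne
  have h2 := Finset.sum_eq_zero_iff.1 h.1 i (Finset.mem_univ i)
  omega

/-- The inclusion of the `i`-th matrix block. -/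
def blockIncl (F : Type*) [Field F] (m : ℕ) {u : ℕ} (n : Fin u → ℕ) (a : ℕ) (i : Fin u) :
    Matrix (Fin (n i)) (Fin m) F →ₗ[F] Space F m n a :=
  LinearMap.inl F _ _ ∘ₗ LinearMap.single F (fun i => Matrix (Fin (n i)) (Fin m) F) i

lemma blockIncl_apply (i : Fin u) (M : Matrix (Fin (n i)) (Fin m) F) :
    blockIncl F m n a i M = (Pi.single i M, 0) := rfl

lemma blockIncl_injective (i : Fin u) : Function.Injective (blockIncl F m n a i) :=
  fun _ _ h => Pi.single_injective (M := fun i => Matrix (Fin (n i)) (Fin m) F) i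
    (congrArg Prod.fst h)

lemma posBasis_inl_eq (i : Fin u) (r : Fin (n i)) (c : Fin m) : posBasis F m n a (.inl ⟨i, r, c⟩) =
    blockIncl F m n a i (vecMulVec (Pi.single r 1) (Pi.single c 1)) := by
  rw [posBasis_inl, blockIncl_apply, single_eq_single_vecMulVec_single]

lemma srkWeight_blockIncl (i : Fin u) (M : Matrix (Fin (n i)) (Fin m) F) :
    srkWeight (blockIncl F m n a i M) = M.rank := by
  classical
  rw [blockIncl_apply, srkWeight, hammingNorm_zero, add_zero, Finset.sum_eq_single i]
  · simp
  · intro j _ hj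
    simp [Pi.single_eq_of_ne hj]
  · simp

lemma eq_blockIncl_of_forall {X : Space F m n a} {i : Fin u}
    (h : ∀ q, q ≠ Sum.inl i → ¬ CompNe X q) : X = blockIncl F m n a i (X.1 i) := by
  refine Prod.ext (funext fun i' => ?_) (funext fun j => ?_)
  · rcases eq_or_ne i' i with rfl | hne
    · simp [blockIncl_apply]
    · have := h (.inl i') (by simpa using hne)
      simp only [CompNe, Sum.elim_inl, not_not] at this
      simp [blockIncl_apply, this, hne]
  · have := h (.inr j) (by simp)
    simp only [CompNe, Sum.elim_inr, not_not] at this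
    simp [blockIncl_apply, this]

lemma eq_smul_posBasis_of_forall {X : Space F m n a} {j : Fin a}
    (h : ∀ q, q ≠ Sum.inr j → ¬ CompNe X q) : X = X.2 j • posBasis F m n a (.inr j) := by
  rw [posBasis_inr]
  refine Prod.ext (funext fun i => ?_) (funext fun j' => ?_)
  · have := h (.inl i) (by simp)
    simp only [CompNe, Sum.elim_inl, not_not] at this
    simp [this]
  · rcases eq_or_ne j' j with rfl | hne
    · simp
    · have := h (.inr j') (by simpa using hne)
      simp only [CompNe, Sum.elim_inr, not_not] at this
      simp [this, hne]

lemma not_compNe_of_ne {X : Space F m n a} (hX : srkWeight X ≤ 1) {p : Fin u ⊕ Fin a}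
    (hp : CompNe X p) (q : Fin u ⊕ Fin a) (hq : q ≠ p) : ¬ CompNe X q := fun hc => by
  have := two_le_srkWeight hq hc hp
  omega

/-- All elements of `L` have sum-rank weight at most one. -/
def IsThin (L : Submodule F (Space F m n a)) : Prop := ∀ X ∈ L, srkWeight X ≤ 1

/-- Two elements supported on different components would add up to weight at least 2. -/
lemma IsThin.exists_comp {L : Submodule F (Space F m n a)} (hL : IsThin L) (h0 : L ≠ ⊥) :
    ∃ p, ∀ X ∈ L, ∀ q, q ≠ p → ¬ CompNe X q := by
  obtain ⟨X₀, hX₀, hne⟩ := Submodule.exists_mem_ne_zero_of_ne_bot h0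
  obtain ⟨p, hp⟩ := exists_compNe hne
  refine ⟨p, fun Y hY q hq hc => ?_⟩
  have h2 := not_compNe_of_ne (hL _ hX₀) hp q hq
  have h3 := not_compNe_of_ne (hL _ hY) hc p hq.symm
  refine not_compNe_of_ne (hL _ (L.add_mem hX₀ hY)) (compNe_add hp h3) q hq ?_
  rw [add_comm]
  exact compNe_add hc h2

/-- A space of dimension at least two of elements of weight at most one lies in one matrix block,
and its members have a common column or a common row. -/
theorem IsThin.exists_block {L : Submodule F (Space F m n a)} (hL : IsThin L)
    (h2 : 2 ≤ finrank F L) :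
    ∃ i, (∀ X ∈ L, X = blockIncl F m n a i (X.1 i)) ∧
      ((∃ v, ∀ X ∈ L, ∃ w, X = blockIncl F m n a i (vecMulVec v w)) ∨
        ∃ w, ∀ X ∈ L, ∃ v, X = blockIncl F m n a i (vecMulVec v w)) := by
  have h0 : L ≠ ⊥ := by
    rintro rfl
    simp at h2
  obtain ⟨i | j, hp⟩ := hL.exists_comp h0
  · have hX : ∀ X ∈ L, X = blockIncl F m n a i (X.1 i) :=
      fun X hX => eq_blockIncl_of_forall (hp X hX)
    refine ⟨i, hX, ?_⟩
    have := exists_common_of_rank_le_one (L.comap (blockIncl F m n a i)) fun M hM => by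
      rw [← srkWeight_blockIncl (a := a)]
      exact hL _ hM
    have hmem : ∀ X ∈ L, X.1 i ∈ L.comap (blockIncl F m n a i) := fun X h => by
      rw [Submodule.mem_comap, ← hX X h]
      exact h
    rcases this with ⟨v, hv⟩ | ⟨w, hw⟩
    · refine Or.inl ⟨v, fun X h => ?_⟩
      obtain ⟨w, hw⟩ := hv _ (hmem X h)
      exact ⟨w, by rw [← hw]; exact hX X h⟩
    · refine Or.inr ⟨w, fun X h => ?_⟩
      obtain ⟨v, hv⟩ := hw _ (hmem X h)
      exact ⟨v, by rw [← hv]; exact hX X h⟩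
  · exfalso
    -- A Hamming component is only one-dimensional, against the dimension bound.
    have hle : L ≤ Submodule.span F {posBasis F m n a (.inr j)} := by
      intro X hX
      exact Submodule.mem_span_singleton.2 ⟨X.2 j, (eq_smul_posBasis_of_forall (hp X hX)).symm⟩
    have h3 := (Submodule.finrank_mono hle).trans (finrank_span_le_card _)
    simp only [Set.toFinset_singleton, Finset.card_singleton] at h3
    omega

/-- The space of the elements whose `i`-th block has all columns proportional to `v`. -/
def colLine (a : ℕ) (i : Fin u) (v : Fin (n i) → F) : Submodule F (Space F m n a) :=
  LinearMap.range (blockIncl F m n a i ∘ₗ vecMulVecBilin F F v)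

/-- The space of the elements whose `i`-th block has all rows proportional to `w`. -/
def rowLine (n : Fin u → ℕ) (a : ℕ) (i : Fin u) (w : Fin m → F) : Submodule F (Space F m n a) :=
  LinearMap.range (blockIncl F m n a i ∘ₗ (vecMulVecBilin F F).flip w)

lemma mem_colLine {i : Fin u} {v : Fin (n i) → F} {X : Space F m n a} :
    X ∈ colLine a i v ↔ ∃ w, blockIncl F m n a i (vecMulVec v w) = X := Iff.rfl

lemma mem_rowLine {i : Fin u} {w : Fin m → F} {X : Space F m n a} :
    X ∈ rowLine n a i w ↔ ∃ v, blockIncl F m n a i (vecMulVec v w) = X := Iff.rfl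

lemma isThin_colLine (i : Fin u) (v : Fin (n i) → F) : IsThin (colLine (m := m) a i v) := by
  rintro _ ⟨w, rfl⟩
  exact (srkWeight_blockIncl i (vecMulVec v w)).trans_le (rank_vecMulVec_le v w)

lemma isThin_rowLine (i : Fin u) (w : Fin m → F) : IsThin (rowLine n a i w) := by
  rintro _ ⟨v, rfl⟩
  exact (srkWeight_blockIncl i (vecMulVec v w)).trans_le (rank_vecMulVec_le v w)

lemma finrank_colLine {i : Fin u} {v : Fin (n i) → F} (hv : v ≠ 0) :
    finrank F (colLine (m := m) a i v) = m := by
  rw [colLine, LinearMap.finrank_range_of_inj, finrank_fin_fun]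
  refine (blockIncl_injective i).comp fun w w' h => funext fun c => ?_
  obtain ⟨r, hr⟩ := Function.ne_iff.1 hv
  have := congrFun (congrFun h r) c
  exact mul_left_cancel₀ hr this

lemma finrank_rowLine {i : Fin u} {w : Fin m → F} (hw : w ≠ 0) :
    finrank F (rowLine n a i w) = n i := by
  rw [rowLine, LinearMap.finrank_range_of_inj, finrank_fin_fun]
  refine (blockIncl_injective i).comp fun v v' h => funext fun r => ?_
  obtain ⟨c, hc⟩ := Function.ne_iff.1 hw
  have := congrFun (congrFun h r) c
  exact mul_right_cancel₀ hc this

end Weight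

/-! ### Linear isometries respect the matrix and Hamming parts -/

section Isometries

open Module Matrix

variable {F : Type*} [Field F] {m u a : ℕ} {n : Fin u → ℕ}

/-- A linear automorphism of the ambient space preserving the sum-rank weight. -/
def IsIsometry (φ : Space F m n a ≃ₗ[F] Space F m n a) : Prop := ∀ X, srkWeight (φ X) = srkWeight X

lemma IsIsometry.symm {φ : Space F m n a ≃ₗ[F] Space F m n a} (hφ : IsIsometry φ) :
    IsIsometry φ.symm := fun X => by
  rw [← hφ, LinearEquiv.apply_symm_apply]

lemma IsIsometry.trans {φ ψ : Space F m n a ≃ₗ[F] Space F m n a} (hφ : IsIsometry φ)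
    (hψ : IsIsometry ψ) : IsIsometry (φ.trans ψ) := fun X => by
  rw [LinearEquiv.trans_apply, hψ, hφ]

lemma isometric_iff {A A' : Submodule F (Space F m n a)} : Isometric srkDist A A' ↔
    ∃ φ : Space F m n a ≃ₗ[F] Space F m n a, IsIsometry φ ∧ A.map φ.toLinearMap = A' := by
  constructor
  · rintro ⟨φ, hA, hφ⟩
    have hw : ∀ X, srkWeight (φ X) = srkWeight X := fun X => by
      have := hφ X 0
      rw [srkDist_eq, srkDist_eq, map_zero, sub_zero, sub_zero] at this
      exact this.symm
    have hinj : Function.Injective φ := by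
      rw [injective_iff_map_eq_zero]
      intro X hX
      refine eq_zero_of_srkWeight_eq_zero ?_
      rw [← hw, hX]
      classical
      simp [srkWeight]
    refine ⟨LinearEquiv.ofInjectiveEndo φ hinj, hw, ?_⟩
    rw [← hA]
    rfl
  · rintro ⟨φ, hφ, rfl⟩
    refine ⟨φ.toLinearMap, rfl, fun X Y => ?_⟩
    rw [srkDist_eq, srkDist_eq, ← map_sub]
    exact (hφ _).symm

lemma IsThin.map {L : Submodule F (Space F m n a)} (hL : IsThin L)
    {φ : Space F m n a ≃ₗ[F] Space F m n a} (hφ : IsIsometry φ) :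
    IsThin (L.map φ.toLinearMap) := by
  rintro _ ⟨X, hX, rfl⟩
  exact (hφ X).trans_le (hL X hX)

namespace IsIsometry

variable {φ : Space F m n a ≃ₗ[F] Space F m n a}

/-- For nonzero `v`, the matrix lies in the thin space `colLine a i v` of dimension m. Since m ≥ 2,
its image must lie in a matrix block. -/
lemma snd_blockIncl_vecMulVec (hφ : IsIsometry φ) (hm : 2 ≤ m) (i : Fin u) (v : Fin (n i) → F)
    (w : Fin m → F) : (φ (blockIncl F m n a i (vecMulVec v w))).2 = 0 := by
  by_cases hv : v = 0
  · have : vecMulVec v w = 0 := by ext; simp [hv, vecMulVec_apply]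
    simp [this]
  obtain ⟨j, hj, -⟩ := ((isThin_colLine (m := m) (a := a) i v).map hφ).exists_block (by
    rw [LinearEquiv.finrank_map_eq, finrank_colLine hv]
    exact hm)
  exact congrArg Prod.snd (hj _ (Submodule.mem_map_of_mem (mem_colLine.2 ⟨w, rfl⟩)))

lemma snd_eq_zero (hφ : IsIsometry φ) (hm : 2 ≤ m) {X : Space F m n a} (hX : X.2 = 0) :
    (φ X).2 = 0 := by
  rw [← (posBasis F m n a).sum_repr X, map_sum, Prod.snd_sum]
  refine Finset.sum_eq_zero fun p _ => ?_
  rw [map_smul, Prod.smul_snd]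
  rcases p with ⟨i, r, c⟩ | j
  · rw [posBasis_inl_eq, hφ.snd_blockIncl_vecMulVec hm, smul_zero]
  · rw [posBasis_repr_inr, hX, Pi.zero_apply, zero_smul]

lemma fst_eq_zero (hφ : IsIsometry φ) (hm : 2 ≤ m) {X : Space F m n a} (hX : X.1 = 0) :
    (φ X).1 = 0 := by
  classical
  rw [← (posBasis F m n a).sum_repr X, map_sum, Prod.fst_sum]
  refine Finset.sum_eq_zero fun p _ => ?_
  rw [map_smul, Prod.smul_fst]
  rcases p with ⟨i, r, c⟩ | j
  · rw [posBasis_repr_inl, hX, Pi.zero_apply, Matrix.zero_apply, zero_smul]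
  · suffices h : (φ (posBasis F m n a (.inr j))).1 = 0 by rw [h, smul_zero]
    have hw : srkWeight (φ (posBasis F m n a (.inr j))) ≤ 1 := by
      rw [hφ, posBasis_inr, srkWeight, hammingNorm_eq_sum]
      simp [Pi.single_apply]
    set Y := φ (posBasis F m n a (.inr j)) with hY
    -- A nonzero matrix component would make the image a rank-one block, which the inverse isometry
    -- sends into the matrix part, although its preimage is a Hamming basis vector.
    by_contra hne
    obtain ⟨i, hi⟩ := Function.ne_iff.1 hne
    have hYi : Y = blockIncl F m n a i (Y.1 i) :=
      eq_blockIncl_of_forall (not_compNe_of_ne hw hi)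
    have hr : (Y.1 i).rank ≤ 1 := by
      rw [← srkWeight_blockIncl (a := a), ← hYi]
      exact hw
    obtain ⟨v, w, hvw⟩ := exists_eq_vecMulVec hr
    have h := hφ.symm.snd_blockIncl_vecMulVec hm i v w
    rw [← hvw, ← hYi, hY, LinearEquiv.symm_apply_apply, posBasis_inr] at h
    simpa using congrFun h j

lemma anticodeWeight_apply (hφ : IsIsometry φ) (hm : 2 ≤ m) (X : Space F m n a) :
    anticodeWeight (φ X) = anticodeWeight X := by
  have hX : X = (X.1, 0) + (0, X.2) := by simp
  have h1 := hφ.snd_eq_zero hm (X := (X.1, 0)) rfl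
  have h2 := hφ.fst_eq_zero hm (X := (0, X.2)) rfl
  have h3 : φ X = φ (X.1, 0) + φ (0, X.2) := by rw [← map_add, ← hX]
  have h4 : ((φ X).1, 0) = φ (X.1, 0) := by
    rw [h3, Prod.fst_add, h2, add_zero]
    exact Prod.ext rfl h1.symm
  have h5 : (0, (φ X).2) = φ (0, X.2) := by
    rw [h3, Prod.snd_add, h1, zero_add]
    exact Prod.ext h2.symm rfl
  rw [anticodeWeight_eq, anticodeWeight_eq, h4, h5, hφ, hφ]

end IsIsometry

lemma IsOptimalAnticode.map {A : Submodule F (Space F m n a)} (hA : IsOptimalAnticode A)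
    (hm : 2 ≤ m) {φ : Space F m n a ≃ₗ[F] Space F m n a} (hφ : IsIsometry φ) :
    IsOptimalAnticode (A.map φ.toLinearMap) := by
  rw [IsOptimalAnticode, LinearEquiv.finrank_map_eq]
  refine ⟨?_, ?_⟩
  · obtain ⟨X, hX, h⟩ := hA.1
    exact ⟨φ X, Submodule.mem_map_of_mem hX, by rw [hφ.anticodeWeight_apply hm, h]⟩
  · rintro w ⟨_, ⟨X, hX, rfl⟩, rfl⟩
    exact (hφ.anticodeWeight_apply hm X).trans_le (hA.2 ⟨X, hX, rfl⟩)

lemma IsSOA.map {A : Submodule F (Space F m n a)} (hA : IsSOA A) (hm : 2 ≤ m)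
    {φ : Space F m n a ≃ₗ[F] Space F m n a} (hφ : IsIsometry φ) :
    IsSOA (A.map φ.toLinearMap) := by
  refine ⟨hA.1.map hm hφ, ?_⟩
  obtain ⟨S, hS, hiso⟩ := hA.2
  obtain ⟨ψ, hψ, h⟩ := isometric_iff.1 hiso
  refine ⟨S, hS, isometric_iff.2 ⟨φ.symm.trans ψ, hφ.symm.trans hψ, ?_⟩⟩
  rw [← h]
  ext X
  simp

theorem isMetricFamily_mSOA (hm : 2 ≤ m) : IsMetricFamily srkDist (mSOA F m n a) := by
  rintro A ⟨hA, hd⟩ A' hiso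
  obtain ⟨φ, hφ, rfl⟩ := isometric_iff.1 hiso
  exact ⟨hA.map hm hφ, by rwa [LinearEquiv.finrank_map_eq]⟩

end Isometries

/-! ### Changes of basis in rows and columns of the blocks -/

section BlockMap

open Module Matrix

variable {F : Type*} [Field F] {m u a : ℕ} {n : Fin u → ℕ}

/-- The automorphism `X_i ↦ P_i X_i Q_i` of the matrix blocks, fixing the Hamming part. -/
def blockMap (a : ℕ) (P : ∀ i, (Matrix (Fin (n i)) (Fin (n i)) F)ˣ)
    (Q : Fin u → (Matrix (Fin m) (Fin m) F)ˣ) : Space F m n a ≃ₗ[F] Space F m n a where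
  toFun X := (fun i => (P i).val * X.1 i * (Q i).val, X.2)
  invFun X := (fun i => (P i)⁻¹.val * X.1 i * (Q i)⁻¹.val, X.2)
  map_add' X Y := by
    refine Prod.ext (funext fun i => ?_) rfl
    simp [Matrix.mul_add, Matrix.add_mul]
  map_smul' c X := by
    refine Prod.ext (funext fun i => ?_) rfl
    simp
  left_inv X := by
    refine Prod.ext (funext fun i => ?_) rfl
    simp only [Matrix.mul_assoc, Units.mul_inv, Matrix.mul_one]
    rw [← Matrix.mul_assoc, Units.inv_mul, Matrix.one_mul]
  right_inv X := by
    refine Prod.ext (funext fun i => ?_) rfl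
    simp only [Matrix.mul_assoc, Units.inv_mul, Matrix.mul_one]
    rw [← Matrix.mul_assoc, Units.mul_inv, Matrix.one_mul]

variable {P : ∀ i, (Matrix (Fin (n i)) (Fin (n i)) F)ˣ} {Q : Fin u → (Matrix (Fin m) (Fin m) F)ˣ}

lemma blockMap_fst (X : Space F m n a) (i : Fin u) :
    (blockMap a P Q X).1 i = (P i).val * X.1 i * (Q i).val := rfl

lemma blockMap_snd (X : Space F m n a) : (blockMap a P Q X).2 = X.2 := rfl

lemma isIsometry_blockMap : IsIsometry (blockMap a P Q) := by
  intro X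
  rw [srkWeight, srkWeight, blockMap_snd]
  congr 1
  refine Finset.sum_congr rfl fun i _ => ?_
  rw [blockMap_fst, rank_mul_eq_left_of_isUnit_det _ _ ((isUnit_iff_isUnit_det _).1 (Q i).isUnit),
    rank_mul_eq_right_of_isUnit_det _ _ ((isUnit_iff_isUnit_det _).1 (P i).isUnit)]

lemma blockMap_blockIncl (i : Fin u) (M : Matrix (Fin (n i)) (Fin m) F) :
    blockMap a P Q (blockIncl F m n a i M) =
      blockIncl F m n a i ((P i).val * M * (Q i).val) := by
  refine Prod.ext (funext fun j => ?_) rfl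
  rw [blockMap_fst, blockIncl_apply, blockIncl_apply]
  rcases eq_or_ne j i with rfl | hne
  · simp
  · simp [hne]

lemma blockMap_blockIncl_vecMulVec (i : Fin u) (v : Fin (n i) → F) (w : Fin m → F) :
    blockMap a P Q (blockIncl F m n a i (vecMulVec v w)) =
      blockIncl F m n a i (vecMulVec ((P i).val *ᵥ v) (w ᵥ* (Q i).val)) := by
  rw [blockMap_blockIncl, mul_vecMulVec, vecMulVec_mul]

lemma blockMap_posBasis_inr (j : Fin a) :
    blockMap a P Q (posBasis F m n a (.inr j)) = posBasis F m n a (.inr j) := by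
  rw [posBasis_inr]
  refine Prod.ext (funext fun i => ?_) rfl
  simp [blockMap_fst]

/-- The transpose of an invertible matrix. -/
def transposeUnit {k : ℕ} (P : (Matrix (Fin k) (Fin k) F)ˣ) : (Matrix (Fin k) (Fin k) F)ˣ where
  val := P.valᵀ
  inv := P⁻¹.valᵀ
  val_inv := by rw [← transpose_mul, Units.inv_mul, transpose_one]
  inv_val := by rw [← transpose_mul, Units.mul_inv, transpose_one]

/-- The columns of `P` form a basis of the whole space extending a basis of `U`. -/
lemma exists_unit_span_eq {k : ℕ} (U : Submodule F (Fin k → F)) :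
    ∃ P : (Matrix (Fin k) (Fin k) F)ˣ,
      U ≤ Submodule.span F {v | v ∈ U ∧ ∃ r, v = P.val *ᵥ Pi.single r 1} := by
  set s := Basis.ofVectorSpace F U with hs
  have hli : LinearIndepOn F id (Set.range fun x => (s x : Fin k → F)) :=
    (s.linearIndependent.map' U.subtype U.ker_subtype).linearIndepOn_id
  set b₀ := Basis.extend hli with hb₀
  set b := b₀.reindex (b₀.indexEquiv (Pi.basisFun F (Fin k))) with hb
  let := (Pi.basisFun F (Fin k)).invertibleToMatrix b
  refine ⟨unitOfInvertible ((Pi.basisFun F (Fin k)).toMatrix b), ?_⟩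
  intro x hx
  have h1 := s.mem_span ⟨x, hx⟩
  have h2 : x ∈ Submodule.span F (Set.range fun y => (s y : Fin k → F)) := by
    have := Submodule.mem_map_of_mem (f := U.subtype) h1
    rw [Submodule.map_span, ← Set.range_comp] at this
    exact this
  refine Submodule.span_mono ?_ h2
  rintro _ ⟨y, rfl⟩
  refine ⟨(s y).2, ?_⟩
  obtain ⟨z, hz⟩ : (s y : Fin k → F) ∈ Set.range b₀ := by
    rw [hb₀, Basis.range_extend]
    exact hli.subset_extend _ ⟨y, rfl⟩
  refine ⟨b₀.indexEquiv (Pi.basisFun F (Fin k)) z, ?_⟩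
  change (s y : Fin k → F) = (Pi.basisFun F (Fin k)).toMatrix b *ᵥ _
  rw [mulVec_single_one]
  ext r
  rw [col_apply, Basis.toMatrix_apply, Pi.basisFun_repr, hb, Basis.reindex_apply,
    Equiv.symm_apply_apply, hz]

end BlockMap

/-! ### Standard optimal anticodes as sums of lines -/

section Lines

open Module Matrix

variable {F : Type*} [Field F] {m u a : ℕ} {n : Fin u → ℕ}

/-- A space of elements of weight at most one, either of dimension `m` or in the Hamming part. -/
def IsLine (L : Submodule F (Space F m n a)) : Prop :=
  IsThin L ∧ (finrank F L = m ∨ ∀ X ∈ L, X.1 = 0)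

/-- The code `A` is a sum of lines. -/
def IsLineGenerated (A : Submodule F (Space F m n a)) : Prop :=
  ∀ A' : Submodule F (Space F m n a), (∀ L, IsLine L → L ≤ A → L ≤ A') → A ≤ A'

lemma IsLine.map {L : Submodule F (Space F m n a)} (hL : IsLine L) (hm : 2 ≤ m)
    {φ : Space F m n a ≃ₗ[F] Space F m n a} (hφ : IsIsometry φ) :
    IsLine (L.map φ.toLinearMap) := by
  refine ⟨hL.1.map hφ, hL.2.imp (fun h => by rwa [LinearEquiv.finrank_map_eq]) ?_⟩
  rintro h _ ⟨X, hX, rfl⟩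
  exact hφ.fst_eq_zero hm (h X hX)

lemma IsLineGenerated.map {A : Submodule F (Space F m n a)} (hA : IsLineGenerated A) (hm : 2 ≤ m)
    {φ : Space F m n a ≃ₗ[F] Space F m n a} (hφ : IsIsometry φ) :
    IsLineGenerated (A.map φ.toLinearMap) := by
  intro A' h
  rw [Submodule.map_le_iff_le_comap]
  refine hA _ fun L hL hLA => ?_
  rw [← Submodule.map_le_iff_le_comap]
  exact h _ (hL.map hm hφ) (Submodule.map_mono hLA)

/-- Each basis vector of the code lies on a line inside it: a full row `r` of cells is the `colLine`
of the r-th unit vector, a full column is a `rowLine` (of dimension m because the block is square),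
and a Hamming vector spans its own line. -/
lemma LineClosed.isLineGenerated {S : Finset (Pos m n a)} (hS : LineClosed S) :
    IsLineGenerated (coordCode F S) := by
  classical
  intro A' h
  rw [coordCode, Submodule.span_le]
  rintro _ ⟨⟨i, r, c⟩ | j, hp, rfl⟩
  · rw [posBasis_inl_eq]
    rcases hS i with h' | ⟨hn, h'⟩
    · refine h (colLine a i (Pi.single r 1))
        ⟨isThin_colLine _ _, Or.inl (finrank_colLine (by simp))⟩ ?_ (mem_colLine.2 ⟨_, rfl⟩)
      rintro _ ⟨w, rfl⟩
      refine mem_coordCode.2 ⟨fun i' r' c' hp' => ?_, fun j _ => rfl⟩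
      change (Pi.single i (vecMulVec (Pi.single r 1) w) : ∀ i, Matrix (Fin (n i)) (Fin m) F)
        i' r' c' = 0
      rcases eq_or_ne i' i with rfl | hne
      · rw [Pi.single_eq_same, vecMulVec_apply]
        rcases eq_or_ne r' r with rfl | hne
        · exact absurd (h' _ c c' hp) hp'
        · rw [Pi.single_eq_of_ne hne, zero_mul]
      · rw [Pi.single_eq_of_ne hne, Matrix.zero_apply]
    · refine h (rowLine n a i (Pi.single c 1))
        ⟨isThin_rowLine _ _, Or.inl ((finrank_rowLine (by simp)).trans hn)⟩ ?_
        (mem_rowLine.2 ⟨_, rfl⟩)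
      rintro _ ⟨v, rfl⟩
      refine mem_coordCode.2 ⟨fun i' r' c' hp' => ?_, fun j _ => rfl⟩
      change (Pi.single i (vecMulVec v (Pi.single c 1)) : ∀ i, Matrix (Fin (n i)) (Fin m) F)
        i' r' c' = 0
      rcases eq_or_ne i' i with rfl | hne
      · rw [Pi.single_eq_same, vecMulVec_apply]
        rcases eq_or_ne c' c with rfl | hne
        · exact absurd (h' r r' _ hp) hp'
        · rw [Pi.single_eq_of_ne hne, mul_zero]
      · rw [Pi.single_eq_of_ne hne, Matrix.zero_apply]
  · refine h (Submodule.span F {posBasis F m n a (.inr j)}) ⟨?_, Or.inr ?_⟩ ?_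
      (Submodule.mem_span_singleton_self _)
    · intro X hX
      obtain ⟨d, rfl⟩ := Submodule.mem_span_singleton.1 hX
      rw [posBasis_inr, srkWeight, hammingNorm_eq_sum]
      simp only [Prod.smul_fst, Prod.smul_snd, smul_zero, Pi.zero_apply, rank_zero,
        Finset.sum_const_zero, zero_add, Pi.smul_apply, smul_eq_mul]
      rw [Finset.sum_eq_single j (fun j' _ hj' => by simp [hj']) (by simp)]
      split_ifs <;> simp
    · intro X hX
      obtain ⟨d, rfl⟩ := Submodule.mem_span_singleton.1 hX
      simp [posBasis_inr]
    · rw [Submodule.span_singleton_le_iff_mem]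
      exact Submodule.subset_span ⟨_, hp, rfl⟩

/-- The common columns `v` of the spaces `colLine a i v` contained in `A`. -/
def colSpace (A : Submodule F (Space F m n a)) (i : Fin u) : Submodule F (Fin (n i) → F) :=
  ⨅ w, A.comap (blockIncl F m n a i ∘ₗ (vecMulVecBilin F F).flip w)

/-- The common rows `w` of the spaces `rowLine n a i w` contained in `A`. -/
def rowSpace (A : Submodule F (Space F m n a)) (i : Fin u) : Submodule F (Fin m → F) :=
  ⨅ v, A.comap (blockIncl F m n a i ∘ₗ vecMulVecBilin F F v)

lemma mem_colSpace {A : Submodule F (Space F m n a)} {i : Fin u} {v : Fin (n i) → F} :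
    v ∈ colSpace A i ↔ ∀ w, blockIncl F m n a i (vecMulVec v w) ∈ A := by
  rw [colSpace, Submodule.mem_iInf]
  rfl

lemma mem_rowSpace {A : Submodule F (Space F m n a)} {i : Fin u} {w : Fin m → F} :
    w ∈ rowSpace A i ↔ ∀ v, blockIncl F m n a i (vecMulVec v w) ∈ A := by
  rw [rowSpace, Submodule.mem_iInf]
  rfl

lemma map_mem_of_forall_single {k : ℕ} {W : Type*} [AddCommGroup W] [Module F W]
    {A : Submodule F W} (g : (Fin k → F) →ₗ[F] W) (h : ∀ c, g (Pi.single c 1) ∈ A)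
    (w : Fin k → F) : g w ∈ A := by
  rw [pi_eq_sum_univ' w, map_sum]
  exact Submodule.sum_mem _ fun c _ => by
    rw [map_smul]
    exact Submodule.smul_mem _ _ (h c)

/-- A sum of lines becomes a code spanned by standard basis vectors after changes of bases in the
rows and columns of the blocks. -/
theorem IsLineGenerated.exists_blockMap {A : Submodule F (Space F m n a)} (hA : IsLineGenerated A)
    (hm : 2 ≤ m) (hn : ∀ i, n i ≤ m) :
    ∃ P Q S, A = (coordCode F S).map (blockMap a P Q).toLinearMap := by
  classical
  -- The bases are adapted to the column and row directions of the lines in `A`. `S` collects the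
  -- positions whose transformed basis vector lies in `A`, so only the inclusion of `A` needs the
  -- lines.
  choose P hP using fun i => exists_unit_span_eq (colSpace A i)
  choose R hR using fun i => exists_unit_span_eq (rowSpace A i)
  set Q := fun i => transposeUnit (R i) with hQ
  set S : Finset (Pos m n a) :=
    Finset.univ.filter fun p => blockMap a P Q (posBasis F m n a p) ∈ A with hS
  have hmemS : ∀ p, p ∈ S ↔ blockMap a P Q (posBasis F m n a p) ∈ A := fun p => by simp [hS]
  refine ⟨P, Q, S, le_antisymm ?_ ?_⟩
  · set A' := (coordCode F S).map (blockMap a P Q).toLinearMap with hA'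
    have hbasis : ∀ p, blockMap a P Q (posBasis F m n a p) ∈ A →
        blockMap a P Q (posBasis F m n a p) ∈ A' := fun p hp =>
      Submodule.mem_map_of_mem (Submodule.subset_span ⟨p, (hmemS p).2 hp, rfl⟩)
    -- It is enough to treat the basis vectors P e_r of `colSpace A i`; for such `r` the whole row
    -- of cells belongs to `S`.
    have hcol : ∀ i, colSpace A i ≤ colSpace A' i := by
      intro i
      refine (hP i).trans (Submodule.span_le.2 ?_)
      rintro _ ⟨hv, r, rfl⟩
      refine mem_colSpace.2 fun w => ?_
      have hw : w = (w ᵥ* (Q i)⁻¹.val) ᵥ* (Q i).val := by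
        rw [vecMul_vecMul, Units.inv_mul, vecMul_one]
      rw [hw, ← blockMap_blockIncl_vecMulVec]
      refine map_mem_of_forall_single ((blockMap a P Q).toLinearMap ∘ₗ blockIncl F m n a i ∘ₗ
        vecMulVecBilin F F (Pi.single r 1)) (fun c => ?_) _
      change blockMap a P Q (blockIncl F m n a i (vecMulVec _ _)) ∈ A'
      rw [← posBasis_inl_eq]
      refine hbasis _ ?_
      rw [posBasis_inl_eq, blockMap_blockIncl_vecMulVec]
      exact mem_colSpace.1 hv _
    have hrow : ∀ i, rowSpace A i ≤ rowSpace A' i := by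
      intro i
      refine (hR i).trans (Submodule.span_le.2 ?_)
      rintro _ ⟨hw, c, rfl⟩
      refine mem_rowSpace.2 fun v => ?_
      have hv : v = (P i).val *ᵥ ((P i)⁻¹.val *ᵥ v) := by
        rw [mulVec_mulVec, Units.mul_inv, one_mulVec]
      have hc : (R i).val *ᵥ Pi.single c 1 = Pi.single c 1 ᵥ* (Q i).val :=
        (vecMul_transpose _ _).symm
      rw [hc] at hw ⊢
      rw [hv, ← blockMap_blockIncl_vecMulVec]
      refine map_mem_of_forall_single ((blockMap a P Q).toLinearMap ∘ₗ blockIncl F m n a i ∘ₗ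
        (vecMulVecBilin F F).flip (Pi.single c 1)) (fun r => ?_) _
      change blockMap a P Q (blockIncl F m n a i (vecMulVec _ _)) ∈ A'
      rw [← posBasis_inl_eq]
      refine hbasis _ ?_
      rw [posBasis_inl_eq, blockMap_blockIncl_vecMulVec]
      exact mem_rowSpace.1 hw _
    refine hA A' fun L hL hLA => ?_
    rcases hL.2 with hf | h0
    · obtain ⟨i, -, ⟨v, hv⟩ | ⟨w, hw⟩⟩ := hL.1.exists_block (by omega)
      · have hle : L ≤ colLine a i v := fun X hX => by
          obtain ⟨w, hw⟩ := hv X hX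
          exact mem_colLine.2 ⟨w, hw.symm⟩
        have heq : L = colLine a i v := Submodule.eq_of_le_of_finrank_le hle (by
          rw [hf]
          exact (LinearMap.finrank_range_le _).trans (by simp))
        have h1 : v ∈ colSpace A i := mem_colSpace.2 fun w =>
          hLA (by rw [heq]; exact mem_colLine.2 ⟨w, rfl⟩)
        intro X hX
        obtain ⟨w, rfl⟩ := hv X hX
        exact mem_colSpace.1 (hcol i h1) w
      · have hle : L ≤ rowLine n a i w := fun X hX => by
          obtain ⟨v, hv⟩ := hw X hX
          exact mem_rowLine.2 ⟨v, hv.symm⟩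
        -- `rowLine` has dimension at most n_i ≤ m = dim L, so `L` fills it.
        have heq : L = rowLine n a i w := Submodule.eq_of_le_of_finrank_le hle (by
          rw [hf]
          exact (LinearMap.finrank_range_le _).trans (by simpa using hn i))
        have h1 : w ∈ rowSpace A i := mem_rowSpace.2 fun v =>
          hLA (by rw [heq]; exact mem_rowLine.2 ⟨v, rfl⟩)
        intro X hX
        obtain ⟨v, rfl⟩ := hw X hX
        exact mem_rowSpace.1 (hrow i h1) v
    · intro X hX
      by_cases hX0 : X = 0
      · rw [hX0]
        exact A'.zero_mem
      obtain ⟨i | j, hp⟩ := exists_compNe hX0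
      · exact absurd (congrFun (h0 X hX) i) hp
      · have hX' := eq_smul_posBasis_of_forall (not_compNe_of_ne (hL.1 X hX) hp)
        have hj : X.2 j ≠ 0 := hp
        have hXA := hLA hX
        rw [hX'] at hXA ⊢
        refine Submodule.smul_mem _ _ ?_
        rw [← blockMap_posBasis_inr (P := P) (Q := Q)]
        refine hbasis _ ?_
        rw [blockMap_posBasis_inr]
        exact (Submodule.smul_mem_iff _ hj).1 hXA
  · rw [coordCode, Submodule.map_span_le]
    rintro _ ⟨p, hp, rfl⟩
    exact (hmemS p).1 hp

/-- Being a sum of lines travels through an arbitrary isometry, which replaces the unknown isometry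
by a `blockMap`. The new position set may differ from the original one; optimality, also an isometry
invariant, shows that it is line closed. -/
theorem isSOA_iff {A : Submodule F (Space F m n a)} (hm : 2 ≤ m) (hn : ∀ i, n i ≤ m) :
    IsSOA A ↔ ∃ P Q S, LineClosed S ∧ A = (coordCode F S).map (blockMap a P Q).toLinearMap := by
  have hmap_symm : ∀ (A : Submodule F (Space F m n a)) (φ : Space F m n a ≃ₗ[F] Space F m n a),
      (A.map φ.toLinearMap).map φ.symm.toLinearMap = A := by
    intro A φ
    ext X
    simp
  constructor
  · rintro ⟨hopt, S, hS, hiso⟩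
    obtain ⟨φ, hφ, hA⟩ := isometric_iff.1 hiso
    obtain ⟨S', hS'⟩ := exists_span_eq_coordCode hS
    rw [hS'] at hA
    have h1 : LineClosed S' := lineClosed_of_isOptimalAnticode (F := F) (by omega) hn (by
      rw [← hA]
      exact hopt.map hm hφ)
    have h2 : IsLineGenerated A := by
      rw [← hmap_symm A φ, hA]
      exact h1.isLineGenerated.map hm hφ.symm
    obtain ⟨P, Q, S'', h3⟩ := h2.exists_blockMap hm hn
    refine ⟨P, Q, S'', lineClosed_of_isOptimalAnticode (F := F) (by omega) hn ?_, h3⟩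
    rw [← hmap_symm (coordCode F S'') (blockMap a P Q), ← h3]
    exact hopt.map hm isIsometry_blockMap.symm
  · rintro ⟨P, Q, S, hS, rfl⟩
    refine ⟨(hS.isOptimalAnticode hn).map hm isIsometry_blockMap, posBasis F m n a '' S, ?_, ?_⟩
    · rw [← range_posBasis]
      exact Set.image_subset_range _ _
    · exact isometric_iff.2 ⟨_, isIsometry_blockMap.symm, hmap_symm _ _⟩

end Lines

/-! ### Duals of coordinate codes and of their images -/

section Duals

open Module Matrix

variable {F : Type*} [Field F] {m u a : ℕ} {n : Fin u → ℕ}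

lemma sumTraceForm_apply (X Y : Space F m n a) :
    sumTraceForm F m n a X Y = ∑ i, trace (X.1 i * (Y.1 i)ᵀ) + ∑ j, X.2 j * Y.2 j := rfl

lemma sumTraceForm_comm (X Y : Space F m n a) :
    sumTraceForm F m n a X Y = sumTraceForm F m n a Y X := by
  rw [sumTraceForm_apply, sumTraceForm_apply]
  congr 1
  · refine Finset.sum_congr rfl fun i _ => ?_
    rw [← trace_transpose, transpose_mul, transpose_transpose]
  · exact Finset.sum_congr rfl fun j _ => mul_comm _ _

lemma sumTraceForm_posBasis (p : Pos m n a) (Y : Space F m n a) :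
    sumTraceForm F m n a (posBasis F m n a p) Y = (posBasis F m n a).repr Y p := by
  rcases p with ⟨i, r, c⟩ | j
  · rw [posBasis_repr_inl, posBasis_inl, sumTraceForm_apply, Finset.sum_eq_single i]
    · simp [trace_single_mul]
    · intro i' _ hne
      simp [hne]
    · simp
  · rw [posBasis_repr_inr, posBasis_inr, sumTraceForm_apply]
    simp [Pi.single_apply]

lemma sumTraceForm_isRefl : (sumTraceForm F m n a).IsRefl := fun X Y h => by
  rwa [sumTraceForm_comm]

lemma sumTraceForm_nondegenerate : (sumTraceForm F m n a).Nondegenerate := by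
  refine (LinearMap.IsRefl.nondegenerate_iff_separatingRight (B := sumTraceForm F m n a)
    fun X Y h => sumTraceForm_isRefl X Y h).2 ?_
  intro Y hY
  refine (posBasis F m n a).repr.map_eq_zero_iff.1 (Finsupp.ext fun p => ?_)
  rw [← sumTraceForm_posBasis, hY, Finsupp.zero_apply]

lemma dualCode_coordCode (S : Finset (Pos m n a)) :
    dualCode (sumTraceForm F m n a) (coordCode F S) = coordCode F Sᶜ := by
  ext Y
  have h1 : Y ∈ coordCode F Sᶜ ↔ ∀ p ∈ S, (posBasis F m n a).repr Y p = 0 := by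
    rw [coordCode, Basis.mem_span_image]
    constructor
    · intro h p hp
      by_contra hne
      exact (Finset.mem_compl.1 (h (Finsupp.mem_support_iff.2 hne))) hp
    · intro h p hp
      exact Finset.mem_compl.2 fun hS => (Finsupp.mem_support_iff.1 hp) (h p hS)
  rw [h1]
  constructor
  · intro hY p hp
    rw [← sumTraceForm_posBasis]
    exact hY _ (Submodule.subset_span ⟨p, hp, rfl⟩)
  · intro h
    have hle : coordCode F S ≤ LinearMap.ker ((sumTraceForm F m n a).flip Y) := by
      rw [coordCode, Submodule.span_le]
      rintro _ ⟨p, hp, rfl⟩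
      exact (sumTraceForm_posBasis p Y).trans (h p hp)
    exact fun X hX => hle hX

/-- The adjoint of X ↦ PXQ for the trace form is Y ↦ PᵀYQᵀ, and the dual of an image is the image of
the dual under the inverse adjoint. -/
lemma dualCode_map_blockMap (A : Submodule F (Space F m n a))
    (P : ∀ i, (Matrix (Fin (n i)) (Fin (n i)) F)ˣ) (Q : Fin u → (Matrix (Fin m) (Fin m) F)ˣ) :
    dualCode (sumTraceForm F m n a) (A.map (blockMap a P Q).toLinearMap) =
      (dualCode (sumTraceForm F m n a) A).map (blockMap a (fun i => (transposeUnit (P i))⁻¹)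
        fun i => (transposeUnit (Q i))⁻¹).toLinearMap := by
  have hadj : ∀ X Y : Space F m n a, sumTraceForm F m n a (blockMap a P Q X) Y =
      sumTraceForm F m n a X (blockMap a (fun i => transposeUnit (P i))
        (fun i => transposeUnit (Q i)) Y) := by
    intro X Y
    rw [sumTraceForm_apply, sumTraceForm_apply]
    congr 1
    refine Finset.sum_congr rfl fun i _ => ?_
    rw [blockMap_fst, blockMap_fst]
    change trace ((P i).val * X.1 i * (Q i).val * (Y.1 i)ᵀ) =
      trace (X.1 i * ((P i).valᵀ * Y.1 i * (Q i).valᵀ)ᵀ)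
    rw [transpose_mul, transpose_mul, transpose_transpose, transpose_transpose, Matrix.mul_assoc,
      Matrix.mul_assoc, trace_mul_comm, Matrix.mul_assoc, Matrix.mul_assoc]
  have hsymm : blockMap a (fun i => (transposeUnit (P i))⁻¹) (fun i => (transposeUnit (Q i))⁻¹) =
      (blockMap a (fun i => transposeUnit (P i)) fun i => transposeUnit (Q i)).symm := rfl
  ext Y
  rw [hsymm, Submodule.mem_map_equiv, LinearEquiv.symm_symm]
  constructor
  · intro h X hX
    exact (hadj X Y).symm.trans (h _ (Submodule.mem_map_of_mem hX))
  · rintro h _ ⟨X, hX, rfl⟩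
    exact (hadj X Y).trans (h X hX)

end Duals

/-! ### The axioms of a test family for m-SOAs -/

section Family

open Module Matrix

variable {F : Type*} [Field F] {m u a : ℕ} {n : Fin u → ℕ}

lemma LineClosed.map_mem_mSOA (hm : 2 ≤ m) (hn : ∀ i, n i ≤ m) {S : Finset (Pos m n a)}
    (hS : LineClosed S) (hd : m ∣ S.card) (P : ∀ i, (Matrix (Fin (n i)) (Fin (n i)) F)ˣ)
    (Q : Fin u → (Matrix (Fin m) (Fin m) F)ˣ) :
    (coordCode F S).map (blockMap a P Q).toLinearMap ∈ mSOA F m n a :=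
  ⟨(isSOA_iff hm hn).2 ⟨P, Q, S, hS, rfl⟩, by rwa [LinearEquiv.finrank_map_eq, finrank_coordCode]⟩

theorem isTestFamily_mSOA (hm : 2 ≤ m) (hn : ∀ i, n i ≤ m) (ha : m ∣ a) :
    IsTestFamily (sumTraceForm F m n a) m (mSOA F m n a) where
  one_le_step := by omega
  step_dvd_dim := by
    rw [finrank_space]
    exact Nat.dvd_add (Dvd.intro _ rfl) ha
  nonempty := ⟨_, LineClosed.map_mem_mSOA hm hn (S := ∅)
    (fun i => Or.inl fun r c c' h => absurd h (Finset.notMem_empty _)) (by simp) 1 1⟩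
  step_dvd A hA := hA.2
  dual_mem A hA := by
    obtain ⟨P, Q, S, hS, rfl⟩ := (isSOA_iff hm hn).1 hA.1
    have hd := hA.2
    rw [LinearEquiv.finrank_map_eq, finrank_coordCode] at hd
    rw [dualCode_map_blockMap, dualCode_coordCode]
    refine hS.compl.map_mem_mSOA hm hn ?_ _ _
    rw [Finset.card_compl]
    refine Nat.dvd_sub ?_ hd
    rw [← finrank_eq_card_basis (posBasis F m n a), finrank_space]
    exact Nat.dvd_add (Dvd.intro _ rfl) ha
  exists_le A hA b hb hpos := by
    obtain ⟨P, Q, S, hS, rfl⟩ := (isSOA_iff hm hn).1 hA.1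
    rw [LinearEquiv.finrank_map_eq, finrank_coordCode] at hb
    have hb0 : 1 ≤ b := Nat.pos_of_mul_pos_right hpos
    obtain ⟨S', hle, hS', hc⟩ := hS.exists_subset (by rw [hb]; exact Nat.le_mul_of_pos_left _ hb0)
    have hc' : S'.card = (b - 1) * m := by
      rw [Nat.sub_mul, one_mul]
      omega
    refine ⟨_, hS'.map_mem_mSOA hm hn (by rw [hc']; exact Dvd.intro_left _ rfl) P Q,
      Submodule.map_mono (Submodule.span_mono (Set.image_mono (by exact_mod_cast hle))), ?_⟩
    rw [LinearEquiv.finrank_map_eq, finrank_coordCode, hc']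
  exists_ge A hA b hb hlt := by
    obtain ⟨P, Q, S, hS, rfl⟩ := (isSOA_iff hm hn).1 hA.1
    rw [LinearEquiv.finrank_map_eq, finrank_coordCode] at hb
    have hcard : finrank F (Space F m n a) = Fintype.card (Pos m n a) :=
      finrank_eq_card_basis (posBasis F m n a)
    have hdvd : m ∣ finrank F (Space F m n a) := by
      rw [finrank_space]
      exact Nat.dvd_add (Dvd.intro _ rfl) ha
    have hcompl : Sᶜ.card = finrank F (Space F m n a) - b * m := by
      rw [Finset.card_compl, hcard, hb]
    -- Enlarging `S` by m positions amounts to removing m positions from its complement, which is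
    -- nonempty of size divisible by m.
    obtain ⟨S', hle, hS', hc⟩ := hS.compl.exists_subset (by
      refine Nat.le_of_dvd (by omega) ?_
      rw [hcompl]
      exact Nat.dvd_sub hdvd (Dvd.intro_left _ rfl))
    have hc' : S'ᶜ.card = (b + 1) * m := by
      rw [Finset.card_compl, add_mul, one_mul]
      omega
    refine ⟨_, hS'.compl.map_mem_mSOA hm hn (by rw [hc']; exact Dvd.intro_left _ rfl) P Q,
      Submodule.map_mono (Submodule.span_mono (Set.image_mono ?_)), ?_⟩
    · have : S ≤ S'ᶜ := le_compl_comm.1 hle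
      exact_mod_cast this
    · rw [LinearEquiv.finrank_map_eq, finrank_coordCode, hc']

end Family

/-! ### Comparison with generalized sum-rank weights -/

section Product

open Module Matrix

variable {F : Type*} [Field F] {m u a : ℕ} {n : Fin u → ℕ}

lemma finrank_productCode (A : ∀ i : Fin u, Submodule F (Matrix (Fin (n i)) (Fin m) F))
    (B : Fin a → Submodule F F) :
    finrank F (productCode A B) = ∑ i, finrank F (A i) + ∑ j, finrank F (B j) := by
  let e : productCode A B ≃ₗ[F] (∀ i, A i) × (∀ j, B j) :=
    { toFun := fun X => (fun i => ⟨X.1.1 i, X.2.1 i trivial⟩, fun j => ⟨X.1.2 j, X.2.2 j trivial⟩)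
      invFun := fun Y => ⟨(fun i => Y.1 i, fun j => Y.2 j),
        fun i _ => (Y.1 i).2, fun j _ => (Y.2 j).2⟩
      map_add' := fun _ _ => rfl
      map_smul' := fun _ _ => rfl
      left_inv := fun _ => rfl
      right_inv := fun _ => rfl }
  rw [e.finrank_eq, finrank_prod, finrank_pi_fintype, finrank_pi_fintype]

/-- Coordinate codes contain the block components of their elements, and `blockMap` acts on each
block separately. -/
lemma IsSOA.blockIncl_mem {A : Submodule F (Space F m n a)} (hA : IsSOA A) (hm : 2 ≤ m)
    (hn : ∀ i, n i ≤ m) {X : Space F m n a} (hX : X ∈ A) (i : Fin u) :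
    blockIncl F m n a i (X.1 i) ∈ A := by
  obtain ⟨P, Q, S, hS, rfl⟩ := (isSOA_iff hm hn).1 hA
  obtain ⟨Y, hY, rfl⟩ := hX
  refine ⟨blockIncl F m n a i (Y.1 i), ?_, blockMap_blockIncl i _⟩
  refine mem_coordCode.2 ⟨fun i' r c h => ?_, fun _ _ => rfl⟩
  rw [blockIncl_apply]
  rcases eq_or_ne i' i with rfl | hne
  · simpa using (mem_coordCode.1 hY).1 _ r c h
  · simp [hne]

lemma IsSOA.exists_eq_productCode {A : Submodule F (Space F m n a)} (hA : IsSOA A) (hm : 2 ≤ m)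
    (hn : ∀ i, n i ≤ m) (ha : a = 0) :
    ∃ A' B, A = productCode A' B := by
  subst ha
  refine ⟨fun i => A.comap (blockIncl F m n 0 i), fun _ => ⊥, le_antisymm ?_ ?_⟩
  · intro X hX
    exact ⟨fun i _ => hA.blockIncl_mem hm hn hX i, fun j => j.elim0⟩
  · rintro X ⟨hX, -⟩
    have : X = ∑ i, blockIncl F m n 0 i (X.1 i) := by
      refine Prod.ext ?_ (funext fun j => j.elim0)
      rw [Prod.fst_sum]
      exact (Finset.univ_sum_single X.1).symm
    rw [this]
    exact Submodule.sum_mem _ fun i _ => hX i trivial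

/-- The dimension is a value of `anticodeWeight`, a multiple of m without Hamming part. Hence every
SOA is then an m-SOA. -/
lemma IsSOA.dvd_finrank {A : Submodule F (Space F m n a)} (hA : IsSOA A) (ha : a = 0) :
    m ∣ finrank F A := by
  classical
  subst ha
  obtain ⟨X, -, hX⟩ := hA.1.1
  have h0 : X.2 = 0 := funext fun j => j.elim0
  rw [hX, anticodeWeight, h0, hammingNorm_zero, add_zero, ← Finset.mul_sum]
  exact Dvd.intro _ rfl

theorem weight_eq_mul_gsrWeight (hm : 2 ≤ m) (hn : ∀ i, n i ≤ m) (ha : a = 0)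
    (C : Submodule F (Space F m n a)) {r : ℕ} (hr : r ≤ finrank F C) :
    (weight (mSOA F m n a) C r : ℝ) = m * gsrWeight C r := by
  have hm0 : (m : ℝ) ≠ 0 := by positivity
  have hsum : ∀ (A : ∀ i : Fin u, Submodule F (Matrix (Fin (n i)) (Fin m) F))
      (B : Fin a → Submodule F F), ∑ i, (finrank F (A i) : ℝ) / m + ∑ j, (finrank F (B j) : ℝ) =
        (finrank F (productCode A B) : ℝ) / m := by
    subst ha
    intro A B
    rw [finrank_productCode]
    simp [Finset.sum_div]
  have hleast : IsLeast {w | ∃ A ∈ mSOA F m n a, r ≤ finrank F ↥(A ⊓ C) ∧ w = finrank F A}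
      (weight (mSOA F m n a) C r) := by
    -- The whole space is an admissible member because r ≤ dim C, so the infimum is attained and is
    -- not the default value 0.
    refine ⟨Nat.sInf_mem ⟨_, ⊤, (isTestFamily_mSOA hm hn (ha ▸ dvd_zero m)).top_mem, ?_, rfl⟩,
      fun w hw => Nat.sInf_le hw⟩
    rwa [top_inf_eq]
  have hleast' : IsLeast {w : ℝ | ∃ (A : ∀ i : Fin u, Submodule F (Matrix (Fin (n i)) (Fin m) F))
      (B : Fin a → Submodule F F), IsSOA (productCode A B) ∧
      r ≤ finrank F ↥(C ⊓ productCode A B) ∧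
      w = ∑ i, (finrank F (A i) : ℝ) / m + ∑ j, (finrank F (B j) : ℝ)}
      ((weight (mSOA F m n a) C r : ℝ) / m) := by
    constructor
    · obtain ⟨A, hA, h1, h2⟩ := hleast.1
      obtain ⟨A', B, rfl⟩ := hA.1.exists_eq_productCode hm hn ha
      exact ⟨A', B, hA.1, by rwa [inf_comm], by rw [hsum, ← h2]⟩
    · rintro _ ⟨A, B, hA, h1, rfl⟩
      rw [hsum]
      gcongr
      exact_mod_cast hleast.2 ⟨_, ⟨hA, hA.dvd_finrank ha⟩, by rwa [inf_comm], rfl⟩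
  rw [gsrWeight, hleast'.csInf_eq, mul_div_cancel₀ _ hm0]

end Product

end TestFamily

end

theorem mainTheorem3 {F : Type*} [Field F] [Finite F] (m t u : ℕ) (n : Fin u → ℕ)
    (hm : 2 ≤ m) (hut : u ≤ t) (hn : ∀ i, 1 ≤ n i ∧ n i ≤ m) (hdvd : m ∣ t - u) :
    -- the dimension of the ambient space
    Module.finrank F (TestFamily.Space F m n (t - u)) = m * ∑ i, n i + (t - u) ∧
    -- the `m`-SOAs form a metric test family with step `m`
    TestFamily.IsTestFamily (TestFamily.sumTraceForm F m n (t - u)) m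
      (TestFamily.mSOA F m n (t - u)) ∧
    TestFamily.IsMetricFamily TestFamily.srkDist (TestFamily.mSOA F m n (t - u)) ∧
    -- duality
    (∀ (C : Submodule F (TestFamily.Space F m n (t - u))) (h : ℕ), h < m →
      {w | ∃ s ∈ Set.Icc 1 (Module.finrank F
            (TestFamily.dualCode (TestFamily.sumTraceForm F m n (t - u)) C)),
          s ≡ h [MOD m] ∧
          w = TestFamily.weight (TestFamily.mSOA F m n (t - u))
            (TestFamily.dualCode (TestFamily.sumTraceForm F m n (t - u)) C) s} =
        {w | w ∈ Set.Icc 1 (m * ∑ i, n i + (t - u)) ∧ m ∣ w} \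
          {w | ∃ r ∈ Set.Icc 1 (Module.finrank F C), r ≡ Module.finrank F C + h [MOD m] ∧
            w = (m * ∑ i, n i + (t - u)) + m -
              TestFamily.weight (TestFamily.mSOA F m n (t - u)) C r}) ∧
    -- the sequences `τ^h(C^⊥)` and `τ^(h+k)(C)` determine each other
    (∀ (C D : Submodule F (TestFamily.Space F m n (t - u))) (h : ℕ), h < m →
      Module.finrank F C = Module.finrank F D →
      (TestFamily.weightSeq (TestFamily.mSOA F m n (t - u)) m h
          (TestFamily.dualCode (TestFamily.sumTraceForm F m n (t - u)) C) =
        TestFamily.weightSeq (TestFamily.mSOA F m n (t - u)) m h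
          (TestFamily.dualCode (TestFamily.sumTraceForm F m n (t - u)) D) ↔
        TestFamily.weightSeq (TestFamily.mSOA F m n (t - u)) m (h + Module.finrank F C) C =
          TestFamily.weightSeq (TestFamily.mSOA F m n (t - u)) m (h + Module.finrank F D) D)) ∧
    -- without Hamming part, the weights are `m` times the generalized sum-rank weights
    (u = t → ∀ (C : Submodule F (TestFamily.Space F m n (t - u))),
      ∀ r ∈ Set.Icc 1 (Module.finrank F C),
        (TestFamily.weight (TestFamily.mSOA F m n (t - u)) C r : ℝ) =
          m * TestFamily.gsrWeight C r) := by
  have hn' : ∀ i, n i ≤ m := fun i => (hn i).2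
  have hT := TestFamily.isTestFamily_mSOA (F := F) hm hn' hdvd
  have hB := TestFamily.sumTraceForm_nondegenerate (F := F) (m := m) (n := n) (a := t - u)
  have hR := TestFamily.sumTraceForm_isRefl (F := F) (m := m) (n := n) (a := t - u)
  refine ⟨TestFamily.finrank_space, hT, TestFamily.isMetricFamily_mSOA hm, fun C h _ => ?_,
    fun C D h _ hCD => hT.weightSeq_dualCode_eq_iff hB hR hCD h, fun hut' C r hr =>
      TestFamily.weight_eq_mul_gsrWeight hm hn' (by omega) C hr.2⟩
  rw [← TestFamily.finrank_space (F := F)]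
  exact hT.weight_duality hB hR C h
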